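/- Let $\Omega\subset\mathbb R^3$ be a bounded open set, let $\mu,\alpha>0$ and $1\le\beta\le 3$. Let $\mathcal V$ be the set of divergence-free fields in $(C_0^\infty(\Omega))^3$, and let $H$ and $V$ be the closures of $\mathcal V$ in $(L^2(\Omega))^3$ and $(H^1_0(\Omega))^3$. Write $(\cdot,\cdot)$, $|\cdot|$ for the inner product and norm of $(L^2(\Omega))^3$, $((u,v))=\sum_{i,j}\int_\Omega\partial_iu_j\,\partial_iv_j\,dx$, $\|u\|^2=((u,u))$ on $V$, $\langle\cdot,\cdot\rangle$ for the duality between $V'$ and $V$ (with $H\subset V'$ via $h\mapsto(h,\cdot)$), $b(u,v,w)=\sum_{i,j}\int_\Omega u_i\,\partial_iv_j\,w_j\,dx$, and, for $N>0$, $F_N(r)=\min(1,N/r)$ for $r>0$, $F_N(0)=1$. For $N>0$, $\tau<T$, $f\in L^2(\tau,T;V')$ and $u_\tau\in H$, a weak solution on $[\tau,T]$ of the globally modified Navier–Stokes equations with damping (GMNSED) with data $N,u_\tau,f$ is a function $u\in L^\infty(\tau,T;H)\cap L^2(\tau,T;V)$, identified with its weakly continuous representative $u\in C([\tau,T];H_w)$,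 with $F_N(\|u\|^{\beta-1})u\in L^{\beta+1}(\tau,T;(L^{\beta+1}(\Omega))^3)$, $u(\tau)=u_\tau$, and $$\frac{d}{dt}(u,w)+\mu((u,w))+F_N(\|u\|)\,b(u,u,w)+\alpha F_N(\|u\|^{\beta-1})\int_\Omega|u|^{\beta-1}u\cdot w\,dx=\langle f,w\rangle$$ in the sense of scalar distributions on $(\tau,T)$, for every $w\in V\cap(L^{\beta+1}(\Omega))^3$. Then weak solutions depend continuously on $N$, $u_\tau$ and $f$. More precisely: (i) There are a constant $C>0$, depending only on $\Omega,\mu,\alpha,\beta$, and constants $\gamma(M,N)>0$, depending only on these and on $M,N>0$, such that for all $M,N>0$ and $\tau<T$, if $u$ and $v$ are weak solutions on $[\tau,T]$ with data $N,u_\tau,f_u$ and $M,v_\tau,f_v$ respectively, and $f_v-f_u\in L^2(\tau,T;H)$, then for all $t\in[\tau,T]$ $$|v(t)-u(t)|^2\le Ce^{\gamma(M,N)(t-\tau)}\Big(|v_\tau-u_\tau|^2+\Big(\int_\tau^t\|u(s)\|^2ds\Big)|M-N|^2+\int_\tau^t|f_v(s)-f_u(s)|^2ds\Big).$$ (ii)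 Let $u$ be a weak solution on $[\tau,T]$ with data $N,u_\tau,f_u$. For every $\varepsilon>0$ there is $\delta>0$ such that every weak solution $v$ on $[\tau,T]$ with data $M,v_\tau,f_v$, where $M>0$, $|M-N|<\delta$, $|v_\tau-u_\tau|<\delta$, $f_v-f_u\in L^2(\tau,T;H)$ and $\int_\tau^T|f_v-f_u|^2ds<\delta$, satisfies $|v(t)-u(t)|<\varepsilon$ for all $t\in[\tau,T]$. -/

import Mathlib

open MeasureTheory Set
open scoped ContDiff RealInnerProductSpace

noncomputable section

namespace GMNSED

/-- Physical space `ℝ³` with the Euclidean norm. -/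
abbrev E3 : Type := EuclideanSpace ℝ (Fin 3)

/-- `3 × 3` matrices with the Hilbert-Schmidt inner product; the entry `(i, j)` of a gradient
is `∂ᵢ uⱼ`. -/
abbrev Mat3 : Type := EuclideanSpace ℝ (Fin 3 × Fin 3)

/-- `(L²(Ω))³`. -/
abbrev L2 (Ω : Set E3) : Type := Lp E3 2 (volume.restrict Ω)

/-- `(L²(Ω))^{3 × 3}`. -/
abbrev L2Mat (Ω : Set E3) : Type := Lp Mat3 2 (volume.restrict Ω)

/-- The classical gradient, with entries `∂ᵢ φⱼ`. -/
def grad (φ : E3 → E3) (x : E3) : Mat3 :=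
  WithLp.toLp 2 fun p => fderiv ℝ φ x (EuclideanSpace.single p.1 (1 : ℝ)) p.2

/-- The class `𝒱` of smooth divergence-free vector fields with compact support in `Ω`. -/
structure IsSolenoidalTest (Ω : Set E3) (φ : E3 → E3) : Prop where
  smooth : ContDiff ℝ ∞ φ
  compact_support : HasCompactSupport φ
  support_subset : tsupport φ ⊆ Ω
  div_free : ∀ x, ∑ i, grad φ x (i, i) = 0

/-- `H`, the closure of `𝒱` in `(L²(Ω))³`. -/
def H (Ω : Set E3) : Submodule ℝ (L2 Ω) :=
  (Submodule.span ℝ {p : L2 Ω | ∃ φ, IsSolenoidalTest Ω φ ∧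
    p =ᵐ[volume.restrict Ω] φ}).topologicalClosure

/-- `V`, the closure of `𝒱` in `(H¹₀(Ω))³`. An element of `V` is represented by the pair
`(u, ∇u)` in `(L²(Ω))³ × (L²(Ω))^{3 × 3}`, and the norm of the pair is the full `H¹` norm. -/
def V (Ω : Set E3) : Submodule ℝ (WithLp 2 (L2 Ω × L2Mat Ω)) :=
  (Submodule.span ℝ {p : WithLp 2 (L2 Ω × L2Mat Ω) | ∃ φ, IsSolenoidalTest Ω φ ∧
    p.fst =ᵐ[volume.restrict Ω] φ ∧ p.snd =ᵐ[volume.restrict Ω] grad φ}).topologicalClosure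

variable {Ω : Set E3}

/-- The field `u` underlying an element of `V`. -/
def fieldV (U : V Ω) : L2 Ω := (U : WithLp 2 (L2 Ω × L2Mat Ω)).fst

/-- The gradient of an element of `V`. -/
def gradV (U : V Ω) : L2Mat Ω := (U : WithLp 2 (L2 Ω × L2Mat Ω)).snd

/-- The second component of an element of `V` is the weak gradient of the first one. -/
theorem weak_grad (U : V Ω) (ψ : E3 → ℝ) (hψ : ContDiff ℝ ∞ ψ)
    (hc : HasCompactSupport ψ) (hs : tsupport ψ ⊆ Ω) (i j : Fin 3) :
    ∫ x in Ω, ψ x * gradV U x (i, j)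
      = -∫ x in Ω, fderiv ℝ ψ x (EuclideanSpace.single i (1 : ℝ)) * fieldV U x j := by
  have hd : Continuous fun x => fderiv ℝ ψ x (EuclideanSpace.single i (1 : ℝ)) :=
    (hψ.continuous_fderiv (by simp)).clm_apply continuous_const
  have hdc : HasCompactSupport fun x => fderiv ℝ ψ x (EuclideanSpace.single i (1 : ℝ)) :=
    hc.fderiv_apply (𝕜 := ℝ) _
  have hA : MemLp (fun x => EuclideanSpace.single (i, j) (ψ x) : E3 → Mat3) 2
      (volume.restrict Ω) := by
    refine (Continuous.memLp_of_hasCompactSupport ?_ ?_)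
    · have := hψ.continuous
      refine (PiLp.continuous_toLp 2 _).comp (continuous_pi fun k => ?_)
      by_cases h : k = (i, j)
      · subst h; simpa using this
      · simpa [h] using continuous_const
    · exact hc.comp_left (g := fun r => (EuclideanSpace.single (i, j) r : Mat3)) (by simp)
  have hB : MemLp (fun x => EuclideanSpace.single j
      (fderiv ℝ ψ x (EuclideanSpace.single i (1 : ℝ))) : E3 → E3) 2
      (volume.restrict Ω) := by
    refine (Continuous.memLp_of_hasCompactSupport ?_ ?_)
    · refine (PiLp.continuous_toLp 2 _).comp (continuous_pi fun k => ?_)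
      by_cases h : k = j
      · subst h; simpa using hd
      · simpa [h] using continuous_const
    · exact hdc.comp_left (g := fun r => (EuclideanSpace.single j r : E3)) (by simp)
  let L : WithLp 2 (L2 Ω × L2Mat Ω) →L[ℝ] ℝ :=
    (innerSL ℝ hA.toLp).comp (WithLp.sndL 2 ℝ (L2 Ω) (L2Mat Ω))
      + (innerSL ℝ hB.toLp).comp (WithLp.fstL 2 ℝ (L2 Ω) (L2Mat Ω))
  have hL : ∀ p : WithLp 2 (L2 Ω × L2Mat Ω), L p = (∫ x in Ω, ψ x * p.snd x (i, j))
      + ∫ x in Ω, fderiv ℝ ψ x (EuclideanSpace.single i (1 : ℝ)) * p.fst x j := by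
    intro p
    simp only [L, add_apply, ContinuousLinearMap.comp_apply, innerSL_apply_apply,
      L2.inner_def]
    congr 1
    · refine integral_congr_ae ?_
      filter_upwards [hA.coeFn_toLp] with x hx
      rw [hx]; simp [EuclideanSpace.inner_single_left]
    · refine integral_congr_ae ?_
      filter_upwards [hB.coeFn_toLp] with x hx
      rw [hx]; simp [EuclideanSpace.inner_single_left]
  have key : L (U : WithLp 2 (L2 Ω × L2Mat Ω)) = 0 := by
    have : V Ω ≤ LinearMap.ker (L : WithLp 2 (L2 Ω × L2Mat Ω) →ₗ[ℝ] ℝ) := by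
      refine Submodule.topologicalClosure_minimal _ (Submodule.span_le.2 ?_)
        (ContinuousLinearMap.isClosed_ker L)
      rintro p ⟨φ, hφ, h1, h2⟩
      show L p = 0
      rw [hL]
      have e1 : ∫ x in Ω, ψ x * p.snd x (i, j) = ∫ x, ψ x * grad φ x (i, j) := by
        rw [← setIntegral_eq_integral_of_forall_compl_eq_zero (s := Ω)
          (f := fun x => ψ x * grad φ x (i, j))]
        · refine integral_congr_ae ?_
          filter_upwards [h2] with x hx
          rw [hx]
        · intro x hx
          rw [image_eq_zero_of_notMem_tsupport fun h => hx (hs h), zero_mul]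
      have e2 : ∫ x in Ω, fderiv ℝ ψ x (EuclideanSpace.single i (1 : ℝ)) * p.fst x j
          = ∫ x, fderiv ℝ ψ x (EuclideanSpace.single i (1 : ℝ)) * φ x j := by
        rw [← setIntegral_eq_integral_of_forall_compl_eq_zero (s := Ω)
          (f := fun x => fderiv ℝ ψ x (EuclideanSpace.single i (1 : ℝ)) * φ x j)]
        · refine integral_congr_ae ?_
          filter_upwards [h1] with x hx
          rw [hx]
        · intro x hx
          rw [image_eq_zero_of_notMem_tsupport fun h => hx (hφ.support_subset h)]; simp
      have hφj : ContDiff ℝ ∞ fun x => φ x j := (contDiff_euclidean.1 hφ.smooth) j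
      have e3 : ∀ x, grad φ x (i, j)
          = fderiv ℝ (fun x => φ x j) x (EuclideanSpace.single i (1 : ℝ)) := by
        intro x
        have hdφ : HasFDerivAt φ (fderiv ℝ φ x) x :=
          (hφ.smooth.differentiable (by simp) x).hasFDerivAt
        have := (PiLp.proj (𝕜 := ℝ) 2 (fun _ : Fin 3 => ℝ) j).hasFDerivAt.comp x hdφ
        have h' : fderiv ℝ (fun x => φ x j) x = _ := this.fderiv
        rw [h']; simp [grad]
      have hj : Continuous fun x =>
          fderiv ℝ (fun x => φ x j) x (EuclideanSpace.single i (1 : ℝ)) :=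
        (hφj.continuous_fderiv (by simp)).clm_apply continuous_const
      rw [e1, e2]
      simp_rw [e3]
      rw [integral_mul_fderiv_eq_neg_fderiv_mul_of_integrable, neg_add_cancel]
      · exact (hd.mul hφj.continuous).integrable_of_hasCompactSupport hdc.mul_right
      · exact (hψ.continuous.mul hj).integrable_of_hasCompactSupport hc.mul_right
      · exact (hψ.continuous.mul hφj.continuous).integrable_of_hasCompactSupport hc.mul_right
      · exact fun x _ => hψ.differentiable (by simp) x
      · exact fun x _ => hφj.differentiable (by simp) x
    exact this U.2
  rw [hL] at key
  exact eq_neg_of_add_eq_zero_left key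

/-- An element of `V` is determined by its underlying field. -/
theorem fieldV_injective (hΩ : IsOpen Ω) :
    Function.Injective (fieldV : V Ω → L2 Ω) := by
  intro U W h
  have h2 : gradV U = gradV W := by
    have hp : ∀ p : Fin 3 × Fin 3, ∀ᵐ x ∂volume.restrict Ω, gradV (U - W) x p = 0 := by
      rintro ⟨i, j⟩
      have hm : MemLp (fun x => gradV (U - W) x (i, j)) 2 (volume.restrict Ω) :=
        (memLp_piLp_iff.1 (Lp.memLp (gradV (U - W)))) (i, j)
      have hz : ∀ᵐ x ∂(volume : Measure E3), x ∈ Ω → gradV (U - W) x (i, j) = 0 := by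
        refine hΩ.ae_eq_zero_of_integral_contDiff_smul_eq_zero
          (locallyIntegrableOn_of_locallyIntegrable_restrict
            (hm.locallyIntegrable (by norm_num))) ?_
        intro ψ hψ hc hs
        rw [← setIntegral_eq_integral_of_forall_compl_eq_zero (s := Ω)]
        · simp only [smul_eq_mul]
          rw [weak_grad (U - W) ψ hψ hc hs i j, neg_eq_zero]
          have h0 : fieldV (U - W) = 0 := sub_eq_zero.2 h
          rw [h0]
          refine integral_eq_zero_of_ae ?_
          filter_upwards [Lp.coeFn_zero E3 2 (volume.restrict Ω)] with x hx
          rw [hx]; simp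
        · intro x hx
          rw [image_eq_zero_of_notMem_tsupport fun h => hx (hs h), zero_smul]
      exact (ae_restrict_iff' hΩ.measurableSet).2 hz
    have h0 : gradV (U - W) = 0 := by
      refine Lp.ext ?_
      filter_upwards [ae_all_iff.2 hp, Lp.coeFn_zero Mat3 2 (volume.restrict Ω)] with x hx h0
      rw [h0]; ext p; exact hx p
    exact sub_eq_zero.1 h0
  exact Subtype.ext (WithLp.ofLp_injective 2 (Prod.ext h h2))

/-- The inner product `((u, v)) = ∑ᵢⱼ ∫ ∂ᵢ uⱼ ∂ᵢ vⱼ` of `V`. -/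
def innerV (U W : V Ω) : ℝ := ⟪gradV U, gradV W⟫

/-- The norm `‖u‖ = |∇u|` of `V`. -/
def normV (U : V Ω) : ℝ := ‖gradV U‖

/-- The dual space `V'`; the norm is the one dual to the `H¹` norm. -/
abbrev VDual (Ω : Set E3) : Type := V Ω →L[ℝ] ℝ

/-- The embedding of `H` in `V'`: `h` acts as `w ↦ (h, w)`. -/
def toVDual (h : H Ω) : VDual Ω :=
  (innerSL ℝ (h : L2 Ω)).comp ((WithLp.fstL 2 ℝ (L2 Ω) (L2Mat Ω)).comp (V Ω).subtypeL)

/-- `x ∈ V` for an element `x` of `H`. -/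
def MemV (x : H Ω) : Prop := ∃ U : V Ω, fieldV U = (x : L2 Ω)

open Classical in
/-- An element of `H` that lies in `V`, regarded as an element of `V` (and `0` otherwise). -/
def toV (x : H Ω) : V Ω := if h : MemV x then h.choose else 0

/-- `b(u, v, w) = ∑ᵢⱼ ∫_Ω uᵢ ∂ᵢvⱼ wⱼ dx`. -/
def b (U W Z : V Ω) : ℝ :=
  ∫ x in Ω, ∑ i, ∑ j, fieldV U x i * gradV W x (i, j) * fieldV Z x j

/-- `∫_Ω |u|^{β - 1} u · w dx`. -/
def damping (β : ℝ) (U W : V Ω) : ℝ :=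
  ∫ x in Ω, ‖fieldV U x‖ ^ (β - 1) * ⟪fieldV U x, fieldV W x⟫

/-- The cutoff `F_N(r) = min(1, N / r)`, with the value `1` at `r = 0`. -/
def F (N r : ℝ) : ℝ := if r = 0 then 1 else min 1 (N / r)

/-- `u` is a weak solution on `[τ, T]` of the globally modified Navier-Stokes equations with
damping, with viscosity `μ`, damping parameters `α`, `β`, cutoff `N`, forcing `f` and initial
datum `u₀`. As usual, `u` stands for its weakly continuous representative, so that its values at
all times (in particular at `τ`) make sense. -/
structure IsWeakSolution (μ α β N τ T : ℝ) (f : ℝ → VDual Ω) (u₀ : H Ω) (u : ℝ → H Ω) :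
    Prop where
  /-- `f ∈ L²(τ, T; V')` -/
  forcing : MemLp f 2 (volume.restrict (Ioc τ T))
  /-- `u ∈ L^∞(τ, T; H)` -/
  memLp_top : MemLp u ⊤ (volume.restrict (Ioc τ T))
  /-- `u ∈ L²(τ, T; V)` -/
  memV : ∀ᵐ t ∂volume.restrict (Ioc τ T), MemV (u t)
  memLp_V : MemLp (fun t => toV (u t)) 2 (volume.restrict (Ioc τ T))
  /-- `F_N(‖u‖^{β-1}) u ∈ L^{β+1}(τ, T; (L^{β+1}(Ω))³)` -/
  memLp_damping : ∀ᵐ t ∂volume.restrict (Ioc τ T),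
    MemLp (fun x => F N (normV (toV (u t)) ^ (β - 1)) • (u t : L2 Ω) x)
      (ENNReal.ofReal (β + 1)) (volume.restrict Ω)
  lintegral_damping : ∫⁻ t in Ioc τ T,
    eLpNorm (fun x => F N (normV (toV (u t)) ^ (β - 1)) • (u t : L2 Ω) x)
      (ENNReal.ofReal (β + 1)) (volume.restrict Ω) ^ (β + 1) < ⊤
  /-- `u ∈ C([τ, T]; H_w)` -/
  weakly_continuous : ∀ h : H Ω, ContinuousOn (fun t => ⟪u t, h⟫) (Icc τ T)
  initial : u τ = u₀
  /-- For every `w ∈ V ∩ (L^{β+1}(Ω))³`, the equation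
  `d/dt (u,w) + μ((u,w)) + F_N(‖u‖) b(u,u,w) + α F_N(‖u‖^{β-1}) (|u|^{β-1}u, w) = ⟨f,w⟩`
  holds in the sense of scalar distributions on `(τ, T)`. -/
  equation : ∀ w : V Ω, MemLp (fieldV w) (ENNReal.ofReal (β + 1)) (volume.restrict Ω) →
    ∀ ψ : ℝ → ℝ, ContDiff ℝ ∞ ψ → HasCompactSupport ψ → tsupport ψ ⊆ Ioo τ T →
      -(∫ t in τ..T, ⟪(u t : L2 Ω), fieldV w⟫ * deriv ψ t)
        + ∫ t in τ..T,
            (μ * innerV (toV (u t)) w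
              + F N (normV (toV (u t))) * b (toV (u t)) (toV (u t)) w
              + α * (F N (normV (toV (u t)) ^ (β - 1)) * damping β (toV (u t)) w)) * ψ t
        = ∫ t in τ..T, f t w * ψ t

/-- The difference `f₂ - f₁` of two forcings is the element `g` of `L²(τ, T; H)`. -/
def ForcingDiff (τ T : ℝ) (f₁ f₂ : ℝ → VDual Ω) (g : ℝ → H Ω) : Prop :=
  MemLp g 2 (volume.restrict (Ioc τ T)) ∧
    ∀ᵐ t ∂volume.restrict (Ioc τ T), f₂ t - f₁ t = toVDual (g t)

end GMNSED

end

namespace GMNSED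

open Filter Topology

/-! Write w = v - u, and let A_N(u) in V' collect the viscous, convective and damping terms, so that
u' = f_u - A_N(u) and v' = f_v - A_M(v). The cutoffs give A_N linear growth: F_N(r) r ≤ N removes
one factor ‖u‖ from the convection, and the same bound at r = ‖u‖^(β-1) leaves the damping linear in
‖u‖. Here β ≤ 3 enters through V ⊂ L⁶, which puts |u|^β in L². Hence u' and v' lie in L²(τ,T;V'),
every element of V is an admissible test field, and w obeys the energy inequality |w(t)|² ≤ |w(τ)|²
+ 2∫⟨w', w⟩ (`energy_inequality`).

It remains to bound ⟨A_M(v) - A_N(u), w⟩ from below. For the convection, b(u,w,w) = 0 leaves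
F_M(‖v‖) b(w,v,w) + (F_M(‖v‖) - F_N(‖u‖)) b(u,v,w). The first cutoff absorbs ‖v‖; the difference of
cutoffs, weighted by ‖u‖‖v‖, is at most 2|M-N|‖u‖ + N‖w‖ (`IsSobolevConst.convection_sub_le`). For
the damping, a ↦ |a|^(β-1)a is monotone, so only the difference of the cutoffs costs anything, and
it can be charged to whichever field has the smaller norm (`IsSobolevConst.damping_sub_ge`).

Interpolating L³ between L² and L⁶ produces |w|^(1/2)‖w‖^(1/2), so Young's inequality absorbs all
powers of ‖w‖ into the viscosity (`young_absorption`). What is left is 2⟨w', w⟩ ≤ γ|w|² +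
4|M-N|²‖u‖² + |f_v - f_u|² (`opDual_sub_le`), and Gronwall gives (i) with C = 4. Part (ii) follows
because γ is increasing in M, hence bounded for M ≤ N + 1. -/

/-! ### Distributional derivatives in time. -/

theorem integral_deriv_smoothTransition : Integrable (deriv Real.smoothTransition) ∧
    ∫ y, deriv Real.smoothTransition y = 1 := by
  have hsm : ContDiff ℝ ∞ Real.smoothTransition := Real.smoothTransition.contDiff
  have hd : Continuous (deriv Real.smoothTransition) := hsm.continuous_deriv (by simp)
  have hsupp : HasCompactSupport (deriv Real.smoothTransition) := by
    refine HasCompactSupport.intro (isCompact_Icc (a := (0 : ℝ)) (b := 1)) fun y hy => ?_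
    rcases lt_or_ge y 0 with h | h
    · have : Real.smoothTransition =ᶠ[𝓝 y] fun _ => 0 := by
        filter_upwards [Iio_mem_nhds h] with z hz
        exact Real.smoothTransition.zero_of_nonpos (le_of_lt hz)
      rw [this.deriv_eq, deriv_const]
    · have h1 : 1 < y := by
        by_contra hc
        exact hy ⟨h, not_lt.1 hc⟩
      have : Real.smoothTransition =ᶠ[𝓝 y] fun _ => 1 := by
        filter_upwards [Ioi_mem_nhds h1] with z hz
        exact Real.smoothTransition.one_of_one_le (le_of_lt hz)
      rw [this.deriv_eq, deriv_const]
  have hi := hd.integrable_of_hasCompactSupport (μ := volume) hsupp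
  refine ⟨hi, ?_⟩
  have := integral_of_hasDerivAt_of_tendsto (f := Real.smoothTransition)
    (f' := deriv Real.smoothTransition) (m := 0) (n := 1)
    (fun x => (hsm.differentiable (by simp) x).hasDerivAt) hi
    (tendsto_const_nhds.congr' (by
      filter_upwards [eventually_le_atBot (0 : ℝ)] with z hz
      rw [Real.smoothTransition.zero_of_nonpos hz]))
    (tendsto_const_nhds.congr' (by
      filter_upwards [eventually_ge_atTop (1 : ℝ)] with z hz
      rw [Real.smoothTransition.one_of_one_le hz]))
  simpa using this

/-- The derivatives of the rescaled smooth transitions at `c` form an approximate identity. -/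
theorem tendsto_integral_mul_deriv_smoothTransition {x : ℝ → ℝ} (hx : Continuous x) {B : ℝ}
    (hB : ∀ r, |x r| ≤ B) (c : ℝ) :
    Tendsto (fun n : ℕ => ∫ r, x r * ((n + 1 : ℝ) *
      deriv Real.smoothTransition ((n + 1 : ℝ) * (r - c)))) atTop (𝓝 (x c)) := by
  obtain ⟨hi, h1⟩ := integral_deriv_smoothTransition
  have hsub : ∀ n : ℕ, ∫ r, x r * ((n + 1 : ℝ) *
      deriv Real.smoothTransition ((n + 1 : ℝ) * (r - c)))
      = ∫ y, x (c + (n + 1 : ℝ)⁻¹ * y) * deriv Real.smoothTransition y := by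
    intro n
    have hn : (0 : ℝ) < n + 1 := by positivity
    rw [← integral_add_right_eq_self _ c]
    have := Measure.integral_comp_mul_left
      (fun y => x (c + (n + 1 : ℝ)⁻¹ * y) * deriv Real.smoothTransition y) (n + 1 : ℝ)
    rw [abs_of_pos (inv_pos.2 hn), smul_eq_mul, eq_inv_mul_iff_mul_eq₀ hn.ne'] at this
    rw [← this, ← integral_const_mul]
    refine integral_congr_ae (Eventually.of_forall fun r => ?_)
    simp only [add_sub_cancel_right, inv_mul_cancel_left₀ hn.ne']
    rw [add_comm r c]; ring
  simp_rw [hsub]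
  have hl : x c = ∫ y, x c * deriv Real.smoothTransition y := by
    rw [integral_const_mul, h1, mul_one]
  rw [hl]
  have hcd : Continuous (deriv Real.smoothTransition) :=
    (Real.smoothTransition.contDiff (n := 1)).continuous_deriv (by simp)
  refine tendsto_integral_of_dominated_convergence
    (fun y => B * |deriv Real.smoothTransition y|) (fun n => ?_) ?_ (fun n => ?_) ?_
  · exact Continuous.aestronglyMeasurable (by fun_prop)
  · exact hi.abs.const_mul _
  · refine Eventually.of_forall fun y => ?_
    rw [Real.norm_eq_abs, abs_mul]
    exact mul_le_mul_of_nonneg_right (hB _) (abs_nonneg _)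
  · refine Eventually.of_forall fun y => ?_
    refine Tendsto.mul_const _ ((hx.tendsto c).comp ?_)
    have : Tendsto (fun n : ℕ => ((n : ℝ) + 1)⁻¹) atTop (𝓝 0) := by
      simpa [one_div] using tendsto_one_div_add_atTop_nhds_zero_nat (𝕜 := ℝ)
    simpa using (this.mul_const y).const_add c

theorem tendsto_smoothTransition_mul (c r : ℝ) :
    Tendsto (fun n : ℕ => Real.smoothTransition ((n + 1 : ℝ) * (r - c))) atTop
      (𝓝 ((Ioi c).indicator 1 r)) := by
  by_cases h : c < r
  · rw [indicator_of_mem (show r ∈ Ioi c from h)]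
    refine tendsto_const_nhds.congr' ?_
    obtain ⟨m, hm⟩ := exists_nat_ge (r - c)⁻¹
    filter_upwards [eventually_ge_atTop m] with n hn
    symm
    refine Real.smoothTransition.one_of_one_le ?_
    have h0 : 0 < r - c := sub_pos.2 h
    have : (r - c)⁻¹ ≤ n + 1 := by
      have : (m : ℝ) ≤ n := by exact_mod_cast hn
      linarith
    calc (1 : ℝ) = (r - c)⁻¹ * (r - c) := (inv_mul_cancel₀ h0.ne').symm
      _ ≤ _ := mul_le_mul_of_nonneg_right this h0.le
  · rw [indicator_of_notMem (show r ∉ Ioi c from h)]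
    refine tendsto_const_nhds.congr fun n => ?_
    symm
    refine Real.smoothTransition.zero_of_nonpos ?_
    exact mul_nonpos_of_nonneg_of_nonpos (by positivity) (by linarith [not_lt.1 h])

/-- A continuous function whose distributional derivative is integrable is the integral of it. -/
theorem sub_eq_integral_of_weak_deriv {a b : ℝ} (hab : a < b) {x k : ℝ → ℝ}
    (hx : ContinuousOn x (Icc a b)) (hk : IntegrableOn k (Ioc a b))
    (h : ∀ ψ : ℝ → ℝ, ContDiff ℝ ∞ ψ → HasCompactSupport ψ → tsupport ψ ⊆ Ioo a b →
      -(∫ t in a..b, x t * deriv ψ t) = ∫ t in a..b, k t * ψ t)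
    {s t : ℝ} (hs : s ∈ Icc a b) (ht : t ∈ Icc a b) : x t - x s = ∫ r in s..t, k r := by
  have key : ∀ s t : ℝ, a < s → s < t → t < b → x t - x s = ∫ r in s..t, k r := by
    intro s t has hst htb
    obtain ⟨y, hyc, hyx, B, hyB⟩ : ∃ y : ℝ → ℝ, Continuous y ∧ (∀ r ∈ Icc a b, y r = x r) ∧
        ∃ B, ∀ r, |y r| ≤ B := by
      refine ⟨IccExtend hab.le ((Icc a b).domRestrict x),
        (continuousOn_iff_continuous_domRestrict.1 hx).Icc_extend', fun r hr => ?_, ?_⟩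
      · rw [IccExtend_of_mem _ _ hr]; rfl
      · obtain ⟨B, hB⟩ := isCompact_Icc.exists_bound_of_continuousOn hx
        exact ⟨B, fun r => hB _ (projIcc a b hab.le r).2⟩
    -- A smooth plateau that rises just after s and falls just after t. It tends to the indicator of
    -- (s, t], and its derivative tends to δ_s - δ_t. Its support lies in [s, t + 1/(n+1)], hence in
    -- (a, b) only for large n.
    set ψ : ℕ → ℝ → ℝ := fun n r => Real.smoothTransition ((n + 1 : ℝ) * (r - s))
      - Real.smoothTransition ((n + 1 : ℝ) * (r - t)) with hψ
    have hψd : ∀ n r, HasDerivAt (ψ n) ((n + 1 : ℝ) * deriv Real.smoothTransition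
        ((n + 1 : ℝ) * (r - s)) - (n + 1 : ℝ) * deriv Real.smoothTransition
        ((n + 1 : ℝ) * (r - t))) r := by
      intro n r
      have hg : ∀ c : ℝ, HasDerivAt (fun r => Real.smoothTransition ((n + 1 : ℝ) * (r - c)))
          ((n + 1 : ℝ) * deriv Real.smoothTransition ((n + 1 : ℝ) * (r - c))) r := by
        intro c
        have h1 : HasDerivAt (fun r : ℝ => (n + 1 : ℝ) * (r - c)) (n + 1 : ℝ) r := by
          simpa using ((hasDerivAt_id r).sub_const c).const_mul (n + 1 : ℝ)
        have h2 := ((Real.smoothTransition.contDiff (n := 1)).differentiable (by simp)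
          ((n + 1 : ℝ) * (r - c))).hasDerivAt
        have := h2.comp r h1
        rwa [mul_comm] at this
      exact (hg s).sub (hg t)
    have hψ0 : ∀ (n : ℕ) r, r ∉ Icc s (t + (n + 1 : ℝ)⁻¹) → ψ n r = 0 := by
      intro n r hr
      have hn : (0 : ℝ) < n + 1 := by positivity
      rcases lt_or_ge r s with h1 | h1
      · simp only [hψ]
        rw [Real.smoothTransition.zero_of_nonpos, Real.smoothTransition.zero_of_nonpos, sub_zero]
        · exact mul_nonpos_of_nonneg_of_nonpos hn.le (by linarith)
        · exact mul_nonpos_of_nonneg_of_nonpos hn.le (by linarith)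
      · have h2 : t + (n + 1 : ℝ)⁻¹ < r := by
          by_contra hc; exact hr ⟨h1, not_lt.1 hc⟩
        have h3 : 1 ≤ (n + 1 : ℝ) * (r - t) := by
          calc (1 : ℝ) = (n + 1 : ℝ) * (n + 1 : ℝ)⁻¹ := (mul_inv_cancel₀ hn.ne').symm
            _ ≤ _ := mul_le_mul_of_nonneg_left (by linarith) hn.le
        simp only [hψ]
        rw [Real.smoothTransition.one_of_one_le, Real.smoothTransition.one_of_one_le h3, sub_self]
        refine h3.trans (mul_le_mul_of_nonneg_left (by linarith) hn.le)
    have hev : ∀ᶠ n : ℕ in atTop, t + ((n : ℝ) + 1)⁻¹ < b := by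
      have : Tendsto (fun n : ℕ => t + ((n : ℝ) + 1)⁻¹) atTop (𝓝 (t + 0)) := by
        refine Tendsto.const_add _ ?_
        simpa [one_div] using tendsto_one_div_add_atTop_nhds_zero_nat (𝕜 := ℝ)
      exact this.eventually_lt_const (by simpa using htb)
    have htest : ∀ᶠ n : ℕ in atTop,
        -((∫ r, y r * ((n + 1 : ℝ) * deriv Real.smoothTransition ((n + 1 : ℝ) * (r - s))))
          - ∫ r, y r * ((n + 1 : ℝ) * deriv Real.smoothTransition ((n + 1 : ℝ) * (r - t))))
          = ∫ r in Ioc a b, k r * ψ n r := by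
      filter_upwards [hev] with n hn
      have hsup : tsupport (ψ n) ⊆ Icc s (t + (n + 1 : ℝ)⁻¹) :=
        closure_minimal (fun r hr => by
          by_contra hc; exact hr (hψ0 n r hc)) isClosed_Icc
      have hcs : HasCompactSupport (ψ n) :=
        HasCompactSupport.of_support_subset_isCompact isCompact_Icc
          (subset_tsupport _ |>.trans hsup)
      have hsub : tsupport (ψ n) ⊆ Ioo a b := fun r hr =>
        ⟨has.trans_le (hsup hr).1, (hsup hr).2.trans_lt hn⟩
      have hsmooth : ContDiff ℝ ∞ (ψ n) := by
        have hg : ∀ c : ℝ, ContDiff ℝ ∞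
            (fun r : ℝ => Real.smoothTransition ((n + 1 : ℝ) * (r - c))) := fun c =>
          Real.smoothTransition.contDiff.comp
            (contDiff_const.mul (contDiff_id.sub contDiff_const))
        exact (hg s).sub (hg t)
      have := h (ψ n) hsmooth hcs hsub
      rw [intervalIntegral.integral_of_le hab.le, intervalIntegral.integral_of_le hab.le] at this
      rw [← this]
      congr 1
      have hint : ∀ c : ℝ, Integrable fun r => y r * ((n + 1 : ℝ) *
          deriv Real.smoothTransition ((n + 1 : ℝ) * (r - c))) := by
        intro c
        have hi := ((integral_deriv_smoothTransition.1.comp_mul_left' (R := (n + 1 : ℝ))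
          (by positivity)).comp_sub_right c).const_mul (n + 1 : ℝ)
        exact hi.bdd_mul (c := B) hyc.aestronglyMeasurable
          (Eventually.of_forall fun r => by simpa using hyB r)
      rw [← integral_sub (hint s) (hint t),
        ← setIntegral_eq_integral_of_forall_compl_eq_zero (s := Ioc a b)]
      · refine setIntegral_congr_fun measurableSet_Ioc fun r hr => ?_
        rw [hyx r ⟨hr.1.le, hr.2⟩, (hψd n r).deriv]; ring
      · intro r hr
        have h0 : deriv (ψ n) r = 0 := by
          refine image_eq_zero_of_notMem_tsupport fun hc => hr ?_
          exact Ioo_subset_Ioc_self (hsub (tsupport_deriv_subset hc))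
        rw [← mul_sub, ← (hψd n r).deriv, h0, mul_zero]
    have hlim1 := ((tendsto_integral_mul_deriv_smoothTransition hyc hyB s).sub
      (tendsto_integral_mul_deriv_smoothTransition hyc hyB t)).neg
    have hlim2 : Tendsto (fun n : ℕ => ∫ r in Ioc a b, k r * ψ n r) atTop
        (𝓝 (∫ r in Ioc a b, k r * (Ioc s t).indicator 1 r)) := by
      refine tendsto_integral_of_dominated_convergence (fun r => |k r|) (fun n => ?_) ?_
        (fun n => ?_) ?_
      · refine hk.aestronglyMeasurable.mul (Continuous.aestronglyMeasurable ?_)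
        exact continuous_iff_continuousAt.2 fun r => (hψd n r).continuousAt
      · exact hk.abs
      · refine Eventually.of_forall fun r => ?_
        rw [Real.norm_eq_abs, abs_mul]
        refine mul_le_of_le_one_right (abs_nonneg _) ?_
        simp only [hψ]
        rw [abs_le]
        have h1 := Real.smoothTransition.nonneg ((n + 1 : ℝ) * (r - s))
        have h2 := Real.smoothTransition.nonneg ((n + 1 : ℝ) * (r - t))
        have h3 := Real.smoothTransition.le_one ((n + 1 : ℝ) * (r - s))
        have h4 := Real.smoothTransition.le_one ((n + 1 : ℝ) * (r - t))
        constructor <;> linarith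
      · refine Eventually.of_forall fun r => Tendsto.const_mul _ ?_
        have := (tendsto_smoothTransition_mul s r).sub (tendsto_smoothTransition_mul t r)
        convert this using 2
        by_cases h1 : s < r <;> by_cases h2 : t < r <;>
          (simp [indicator, h1, h2]; try grind)
    have heq := tendsto_nhds_unique (hlim1.congr' htest) hlim2
    rw [hyx s ⟨has.le, (hst.trans htb).le⟩, hyx t ⟨(has.trans hst).le, htb.le⟩] at heq
    rw [intervalIntegral.integral_of_le hst.le]
    have h5 : ∫ r in Ioc a b, k r * (Ioc s t).indicator 1 r = ∫ r in Ioc s t, k r := by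
      have : (fun r => k r * (Ioc s t).indicator (1 : ℝ → ℝ) r) = (Ioc s t).indicator k := by
        ext r; by_cases hr : r ∈ Ioc s t <;> simp [hr]
      rw [this, setIntegral_indicator measurableSet_Ioc,
        inter_eq_self_of_subset_right (Ioc_subset_Ioc has.le htb.le)]
    rw [← h5, ← heq]; ring
  have hki : IntervalIntegrable k volume a b :=
    (intervalIntegrable_iff_integrableOn_Ioc_of_le hab.le).2 hk
  -- The plateaus reach interior points only. The endpoints follow by comparing two continuous
  -- functions on [a, b], both normalised to vanish at an interior base point.
  set m := (a + b) / 2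
  have hm : m ∈ Ioo a b := ⟨by simp only [m]; linarith, by simp only [m]; linarith⟩
  have hkm : ∀ r ∈ Icc a b, IntervalIntegrable k volume m r := fun r hr =>
    hki.mono_set (uIcc_subset_uIcc (by rw [uIcc_of_le hab.le]; exact Ioo_subset_Icc_self hm)
      (by rwa [uIcc_of_le hab.le]))
  have hmid : EqOn (fun r => x r - x m) (fun r => ∫ r in m..r, k r) (Icc a b) := by
    have ho : EqOn (fun r => x r - x m) (fun r => ∫ r in m..r, k r) (Ioo a b) := by
      intro r hr
      rcases lt_trichotomy r m with h1 | h1 | h1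
      · simp only
        rw [intervalIntegral.integral_symm, ← key r m hr.1 h1 hm.2]; ring
      · simp [h1]
      · exact key m r hm.1 h1 hr.2
    refine ho.of_subset_closure (hx.sub continuousOn_const) ?_ Ioo_subset_Icc_self
      (closure_Ioo hab.ne).symm.subset
    have := intervalIntegral.continuousOn_primitive_interval' hki
      (by rw [uIcc_of_le hab.le]; exact Ioo_subset_Icc_self hm : m ∈ uIcc a b)
    rwa [uIcc_of_le hab.le] at this
  have e1 := hmid hs
  have e2 := hmid ht
  simp only at e1 e2
  rw [← intervalIntegral.integral_interval_sub_left (hkm t ht) (hkm s hs), ← e1, ← e2]; ring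

/-! ### The energy inequality. -/

/-- The correlation of two square integrable functions depends continuously on the shift. -/
theorem continuous_integral_shift_pairing {D V : Type*} [NormedAddCommGroup D] [NormedSpace ℝ D]
    [NormedAddCommGroup V] [NormedSpace ℝ V] (P : D →L[ℝ] V →L[ℝ] ℝ)
    {G : ℝ → D} {W : ℝ → V} (hG : MemLp G 2) (hW : MemLp W 2) :
    Continuous fun k : ℝ => ∫ s, P (G (s - k)) (W s) := by
  let Q := P.lpPairing (volume : Measure ℝ) 2 2
  have hQ : ∀ k : ℝ, Q (DomAddAct.mk (-k) +ᵥ hG.toLp G) (hW.toLp W) = ∫ s, P (G (s - k)) (W s) := by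
    intro k
    rw [ContinuousLinearMap.lpPairing_eq_integral, DomAddAct.mk_vadd_toLp]
    refine integral_congr_ae ?_
    filter_upwards [MemLp.coeFn_toLp hW, MemLp.coeFn_toLp
      (hG.comp_measurePreserving (measurePreserving_vadd (-k) volume))] with s h1 h2
    rw [h1]
    exact (congrArg (fun A : D => P A (W s)) h2).trans (by simp [sub_eq_neg_add])
  simp_rw [← hQ]
  -- Translations act continuously on L², and the pairing is bounded on L² × L².
  have hc : Continuous fun k : ℝ => DomAddAct.mk (-k) +ᵥ hG.toLp G := by
    have : Continuous fun k : ℝ => DomAddAct.mk (-k) := by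
      exact DomAddAct.continuous_mk.comp continuous_neg
    have h2 : Fact ((2 : ENNReal) ≠ ⊤) := ⟨by simp⟩
    exact this.vadd continuous_const
  exact (Q.continuous.comp hc).clm_apply continuous_const

/-- If q(0) were positive, q would stay above q(0)/2 near 0 and its integral would be positive
there. In the energy inequality this replaces dividing by the shift h and letting h tend to 0. -/
theorem nonpos_of_integral_nonpos {q : ℝ → ℝ} {d : ℝ} (hd : 0 < d) (hq : ContinuousOn q (Icc 0 d))
    (h : ∀ h ∈ Ioo 0 d, ∫ k in (0 : ℝ)..h, q k ≤ 0) : q 0 ≤ 0 := by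
  by_contra hc
  push Not at hc
  have h0 := hq 0 ⟨le_rfl, hd.le⟩
  have hev : ∀ᶠ k in 𝓝[Icc 0 d] 0, q 0 / 2 < q k := h0.eventually_const_lt (by linarith)
  obtain ⟨e, he, hball⟩ := Metric.mem_nhdsWithin_iff.1 hev
  set m := min (e / 2) (d / 2)
  have hm0 : 0 < m := lt_min (by linarith) (by linarith)
  have hmd : m < d := (min_le_right _ _).trans_lt (by linarith)
  have hme : m < e := (min_le_left _ _).trans_lt (by linarith)
  have hmono : ∫ _ in (0 : ℝ)..m, q 0 / 2 ≤ ∫ k in (0 : ℝ)..m, q k := by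
    refine intervalIntegral.integral_mono_on hm0.le (by simp) ?_ fun k hk => ?_
    · refine ContinuousOn.intervalIntegrable ?_
      rw [uIcc_of_le hm0.le]
      exact hq.mono (Icc_subset_Icc_right hmd.le)
    · refine le_of_lt (hball ⟨?_, hk.1, hk.2.trans hmd.le⟩)
      rw [Metric.mem_ball, Real.dist_eq, sub_zero, abs_of_nonneg hk.1]
      exact hk.2.trans_lt hme
  have := h m ⟨hm0, hmd⟩
  rw [intervalIntegral.integral_const, smul_eq_mul, sub_zero] at hmono
  have : 0 < m * (q 0 / 2) := by positivity
  linarith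

section Energy

variable {H V D : Type*} [NormedAddCommGroup H] [InnerProductSpace ℝ H]
  [NormedAddCommGroup V] [NormedSpace ℝ V] [NormedAddCommGroup D] [NormedSpace ℝ D]

/-- The energy inequality for a function `w ∈ L²(a, b; V)` with a time derivative in
`L²(a, b; V')`, given by its weakly continuous representative. -/
theorem energy_inequality_right (P : D →L[ℝ] V →L[ℝ] ℝ) (J : V →L[ℝ] H) {a b : ℝ}
    (hab : a < b) {w : ℝ → H} {W : ℝ → V} {G : ℝ → D} (hw : ∀ h : H, ContinuousOn (fun t => ⟪w t, h⟫) (Icc a b))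
    (hW : MemLp W 2 (volume.restrict (Ioc a b))) (hG : MemLp G 2 (volume.restrict (Ioc a b)))
    (hJ : ∀ᵐ t ∂volume.restrict (Ioc a b), J (W t) = w t)
    (hwG : ∀ φ : V, ∀ s ∈ Icc a b, ∀ t ∈ Icc a b,
      ⟪w t - w s, J φ⟫ = ∫ r in s..t, P (G r) φ) :
    ‖w b‖ ^ 2 ≤ ‖w a‖ ^ 2 + 2 * ∫ t in a..b, P (G t) (W t) := by
  set Gx : ℝ → D := (Ioc a b).indicator G with hGx
  set Wx : ℝ → V := (Ioc a b).indicator W with hWx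
  have hGx2 : MemLp Gx 2 := (memLp_indicator_iff_restrict measurableSet_Ioc).2 hG
  have hWx2 : MemLp Wx 2 := (memLp_indicator_iff_restrict measurableSet_Ioc).2 hW
  have hGx1 : Integrable Gx :=
    (integrable_indicator_iff measurableSet_Ioc).2 (hG.integrable (by norm_num))
  have hWx1 : Integrable Wx :=
    (integrable_indicator_iff measurableSet_Ioc).2 (hW.integrable (by norm_num))
  -- The method is a backward difference in time, without mollification. One has |w(s)|² - |w(s-h)|²
  -- ≤ 2(w(s) - w(s-h), w(s)), and the right side is the integral of 2⟨G(s-k), W(s)⟩ over 0 < k < h.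
  -- Integrating in s turns it into 2∫₀^h Θ, and Θ(0) is the wanted duality integral.
  set Θ : ℝ → ℝ := fun k => ∫ s, P (Gx (s - k)) (Wx s) with hΘ
  have hΘc : Continuous Θ := continuous_integral_shift_pairing P hGx2 hWx2
  have hΘ0 : Θ 0 = ∫ t in a..b, P (G t) (W t) := by
    rw [intervalIntegral.integral_of_le hab.le, ← integral_indicator measurableSet_Ioc]
    simp only [hΘ, sub_zero]
    congr 1
    ext s
    by_cases hs : s ∈ Ioc a b <;> simp [hGx, hWx, hs]
  -- the energy and its extension to the left of `a`
  set e : ℝ → ℝ := fun s => ‖w (max s a)‖ ^ 2 with he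
  have hea : ∀ s ≤ a, e s = ‖w a‖ ^ 2 := fun s hs => by simp [he, hs]
  have heb : ∀ s, a ≤ s → e s = ‖w s‖ ^ 2 := fun s hs => by simp [he, hs]
  have hwi : IntegrableOn (fun s => ‖w s‖ ^ 2) (Ioc a b) := by
    have h1 : MemLp (fun t => J (W t)) 2 (volume.restrict (Ioc a b)) :=
      J.comp_memLp' hW
    have h2 : MemLp w 2 (volume.restrict (Ioc a b)) := (memLp_congr_ae hJ).1 h1
    exact h2.integrable_norm_pow (by norm_num)
  have heab : IntervalIntegrable e volume a b := by
    rw [intervalIntegrable_iff_integrableOn_Ioc_of_le hab.le]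
    exact hwi.congr_fun (fun s hs => (heb s hs.1.le).symm) measurableSet_Ioc
  have hele : ∀ c, c ≤ a → IntervalIntegrable e volume c a := by
    intro c hc
    rw [intervalIntegrable_iff_integrableOn_Ioc_of_le hc]
    refine IntegrableOn.congr_fun (f := fun _ => ‖w a‖ ^ 2) (by simp)
      (fun s hs => (hea s hs.2).symm) measurableSet_Ioc
  have hei : ∀ c, c ≤ b → IntervalIntegrable e volume c b := by
    intro c hc
    rcases le_total c a with h | h
    · exact (hele c h).trans heab
    · exact heab.mono_set (by rw [uIcc_of_le hc, uIcc_of_le hab.le]; exact Icc_subset_Icc_left h)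
  have hcont : ContinuousOn (fun t => 2 * ⟪w t, w b⟫ - ‖w b‖ ^ 2) (Icc a b) :=
    (continuousOn_const.mul (hw (w b))).sub continuousOn_const
  have hI : Integrable (fun p : ℝ × ℝ => P (Gx (p.2 - p.1)) (Wx p.2)) (volume.prod volume) := by
    simpa using hWx1.convolution_integrand (μ := volume) (ν := volume) P.flip hGx1.comp_neg
  have main : ∀ h ∈ Ioo 0 (b - a), ∫ k in (0 : ℝ)..h,
      ((2 * ⟪w (b - k), w b⟫ - ‖w b‖ ^ 2) - ‖w a‖ ^ 2 - 2 * Θ k) ≤ 0 := by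
    rintro h ⟨h0, hh⟩
    -- the correlation integrated over the shift
    have hswap : ∫ k in (0 : ℝ)..h, Θ k = ∫ s, ∫ k in (0 : ℝ)..h, P (Gx (s - k)) (Wx s) := by
      simp only [hΘ, intervalIntegral.integral_of_le h0.le]
      rw [integral_integral_swap]
      exact hI.mono_measure (Measure.prod_mono Measure.restrict_le_self le_rfl)
    have hinner : ∀ᵐ s ∂volume.restrict (Ioc a b),
        e s - e (s - h) ≤ 2 * ∫ k in (0 : ℝ)..h, P (Gx (s - k)) (Wx s) := by
      filter_upwards [hJ, ae_restrict_mem measurableSet_Ioc] with s hs hsm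
      have e1 : ∫ k in (0 : ℝ)..h, P (Gx (s - k)) (Wx s) = ⟪w s - w (max (s - h) a), w s⟫ := by
        rw [intervalIntegral.integral_comp_sub_left (fun r => P (Gx r) (Wx s)), sub_zero]
        have hmx : max (s - h) a ≤ s := max_le (by linarith) hsm.1.le
        have hws := hwG (W s) _ ⟨le_max_right _ _, hmx.trans hsm.2⟩ s ⟨hsm.1.le, hsm.2⟩
        rw [hs] at hws
        rw [hws,
          intervalIntegral.integral_of_le (by linarith), intervalIntegral.integral_of_le hmx,
          ← integral_indicator measurableSet_Ioc, ← integral_indicator measurableSet_Ioc]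
        refine integral_congr_ae (Eventually.of_forall fun r => ?_)
        simp only [hGx, hWx, indicator_of_mem hsm]
        by_cases h1 : r ∈ Ioc a b
        · by_cases h2 : r ∈ Ioc (s - h) s
          · rw [indicator_of_mem h2, indicator_of_mem (show r ∈ Ioc (max (s - h) a) s from
              ⟨max_lt h2.1 h1.1, h2.2⟩), indicator_of_mem h1]
          · rw [indicator_of_notMem h2, indicator_of_notMem]
            exact fun h3 => h2 ⟨(le_max_left _ _).trans_lt h3.1, h3.2⟩
        · rw [indicator_of_notMem (show r ∉ Ioc (max (s - h) a) s from fun h3 =>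
            h1 ⟨(le_max_right _ _).trans_lt h3.1, h3.2.trans hsm.2⟩)]
          by_cases h2 : r ∈ Ioc (s - h) s
          · rw [indicator_of_mem h2, indicator_of_notMem h1]; simp
          · rw [indicator_of_notMem h2]
      rw [e1, heb s hsm.1.le]
      simp only [he]
      have h1 := norm_sub_sq_real (w s) (w (max (s - h) a))
      have h2 := sq_nonneg ‖w s - w (max (s - h) a)‖
      rw [inner_sub_left, real_inner_self_eq_norm_sq, real_inner_comm]
      linarith
    have hout : ∫ s, ∫ k in (0 : ℝ)..h, P (Gx (s - k)) (Wx s)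
        = ∫ s in Ioc a b, ∫ k in (0 : ℝ)..h, P (Gx (s - k)) (Wx s) := by
      rw [setIntegral_eq_integral_of_forall_compl_eq_zero]
      intro s hs
      simp [hWx, hs]
    have hi2 : IntegrableOn (fun s => 2 * ∫ k in (0 : ℝ)..h, P (Gx (s - k)) (Wx s)) (Ioc a b) := by
      have hI' := (hI.mono_measure (Measure.prod_mono
        (Measure.restrict_le_self (s := Ioc 0 h)) le_rfl)).integral_prod_right
      simp only [intervalIntegral.integral_of_le h0.le]
      exact (hI'.const_mul 2).integrableOn
    have hshift : IntervalIntegrable (fun s => e (s - h)) volume a b := by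
      have := (hei (a - h) (by linarith)).mono_set
        (show uIcc (a - h) (b - h) ⊆ uIcc (a - h) b by
          rw [uIcc_of_le (by linarith), uIcc_of_le (by linarith)]
          exact Icc_subset_Icc_right (by linarith))
      simpa using this.comp_sub_right h
    have hsum : ∫ s in a..b, (e s - e (s - h)) ≤ 2 * ∫ k in (0 : ℝ)..h, Θ k := by
      rw [hswap, hout, ← integral_const_mul, intervalIntegral.integral_of_le hab.le]
      refine setIntegral_mono_ae_restrict ?_ hi2 hinner
      exact ((intervalIntegrable_iff_integrableOn_Ioc_of_le hab.le).1 (heab.sub hshift))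
    -- The shifted integrals cancel except on two end intervals; the left one lies in the constant
    -- extension and equals h|w(a)|² exactly.
    have htel : ∫ s in a..b, (e s - e (s - h)) = (∫ s in (b - h)..b, e s) - h * ‖w a‖ ^ 2 := by
      rw [intervalIntegral.integral_sub heab hshift,
        intervalIntegral.integral_comp_sub_right (fun s => e s) h]
      have h1 := intervalIntegral.integral_add_adjacent_intervals
        (hele (a - h) (by linarith)) heab
      have h2 := intervalIntegral.integral_add_adjacent_intervals
        (((hei (a - h) (by linarith))).mono_set
        (show uIcc (a - h) (b - h) ⊆ uIcc (a - h) b by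
          rw [uIcc_of_le (by linarith), uIcc_of_le (by linarith)]
          exact Icc_subset_Icc_right (by linarith))) (hei (b - h) (by linarith))
      have h3 : ∫ s in (a - h)..a, e s = h * ‖w a‖ ^ 2 := by
        rw [intervalIntegral.integral_congr (g := fun _ => ‖w a‖ ^ 2)]
        · simp
        · intro s hs
          rw [uIcc_of_le (by linarith)] at hs
          exact hea s hs.2
      linarith
    -- The energy itself need not be continuous at b. The lower bound |w(s)|² ≥ 2(w(s), w(b)) -
    -- |w(b)|² is continuous in s by weak continuity, and is an equality at s = b.
    have hlow : ∫ k in (0 : ℝ)..h, (2 * ⟪w (b - k), w b⟫ - ‖w b‖ ^ 2) ≤ ∫ s in (b - h)..b, e s := by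
      rw [intervalIntegral.integral_comp_sub_left (fun s => 2 * ⟪w s, w b⟫ - ‖w b‖ ^ 2), sub_zero]
      refine intervalIntegral.integral_mono_on (by linarith) ?_ (hei _ (by linarith)) ?_
      · refine ContinuousOn.intervalIntegrable ?_
        rw [uIcc_of_le (by linarith)]
        exact hcont.mono (Icc_subset_Icc_left (by linarith))
      · intro s hs
        rw [heb s (by linarith [hs.1])]
        have h1 := norm_sub_sq_real (w s) (w b)
        have h2 := sq_nonneg ‖w s - w b‖
        linarith
    have hq1 : IntervalIntegrable (fun k => 2 * ⟪w (b - k), w b⟫ - ‖w b‖ ^ 2) volume 0 h := by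
      refine ContinuousOn.intervalIntegrable ?_
      refine hcont.comp (g := fun t => 2 * ⟪w t, w b⟫ - ‖w b‖ ^ 2) (f := fun k => b - k)
        (by fun_prop) fun k hk => ?_
      rw [uIcc_of_le h0.le] at hk
      exact ⟨by linarith [hk.2], by linarith [hk.1]⟩
    rw [intervalIntegral.integral_sub (hq1.sub (by simp))
      ((hΘc.const_mul 2).intervalIntegrable _ _), intervalIntegral.integral_sub hq1 (by simp),
      intervalIntegral.integral_const_mul]
    simp only [intervalIntegral.integral_const, sub_zero, smul_eq_mul]
    linarith
  have hfin := nonpos_of_integral_nonpos (sub_pos.2 hab) (q := fun k =>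
    (2 * ⟪w (b - k), w b⟫ - ‖w b‖ ^ 2) - ‖w a‖ ^ 2 - 2 * Θ k) ?_ main
  · simp only [sub_zero, hΘ0, real_inner_self_eq_norm_sq] at hfin
    linarith
  · refine ContinuousOn.sub (ContinuousOn.sub ?_ continuousOn_const)
      (hΘc.const_mul 2).continuousOn
    refine hcont.comp (g := fun t => 2 * ⟪w t, w b⟫ - ‖w b‖ ^ 2) (f := fun k => b - k)
        (by fun_prop) fun k hk => ?_
    exact ⟨by linarith [hk.2], by linarith [hk.1]⟩

/-- Each (w, Jφ) is continuous with integrable distributional derivative, so the equation may be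
integrated between any two times. The inequality at the right endpoint, applied on [a, t], then
holds at every t. -/
theorem energy_inequality (P : D →L[ℝ] V →L[ℝ] ℝ) (J : V →L[ℝ] H) {a b : ℝ}
    (hab : a < b) {w : ℝ → H} {W : ℝ → V} {G : ℝ → D} (hw : ∀ h : H, ContinuousOn (fun t => ⟪w t, h⟫) (Icc a b))
    (hW : MemLp W 2 (volume.restrict (Ioc a b))) (hG : MemLp G 2 (volume.restrict (Ioc a b)))
    (hJ : ∀ᵐ t ∂volume.restrict (Ioc a b), J (W t) = w t)
    (heq : ∀ φ : V, ∀ ψ : ℝ → ℝ, ContDiff ℝ ∞ ψ → HasCompactSupport ψ → tsupport ψ ⊆ Ioo a b →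
      -(∫ t in a..b, ⟪w t, J φ⟫ * deriv ψ t) = ∫ t in a..b, P (G t) φ * ψ t)
    {t : ℝ} (ht : t ∈ Icc a b) :
    ‖w t‖ ^ 2 ≤ ‖w a‖ ^ 2 + 2 * ∫ s in a..t, P (G s) (W s) := by
  rcases ht.1.eq_or_lt with rfl | hat
  · simp
  have hsub : Ioc a t ⊆ Ioc a b := Ioc_subset_Ioc_right ht.2
  have hmono : volume.restrict (Ioc a t) ≤ volume.restrict (Ioc a b) :=
    Measure.restrict_mono hsub le_rfl
  refine energy_inequality_right P J hat (fun h => (hw h).mono (Icc_subset_Icc_right ht.2))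
    (hW.mono_measure hmono) (hG.mono_measure hmono) (ae_mono hmono hJ) fun φ s hs r hr => ?_
  rw [inner_sub_left]
  refine sub_eq_integral_of_weak_deriv hab (hw (J φ)) ?_ (heq φ)
    ⟨hs.1, hs.2.trans ht.2⟩ ⟨hr.1, hr.2.trans ht.2⟩
  exact (P.flip φ).integrable_comp (hG.integrable (by norm_num))

end Energy

/-! ### Gronwall's inequality. -/

/-- Gronwall's inequality in integral form. -/
theorem le_mul_exp_of_le_add_integral {a b A c : ℝ} (hab : a ≤ b) (hc : 0 ≤ c) {φ : ℝ → ℝ}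
    (hφ : IntervalIntegrable φ volume a b)
    (h : ∀ t ∈ Icc a b, φ t ≤ A + c * ∫ s in a..t, φ s) :
    φ b ≤ A * Real.exp (c * (b - a)) := by
  set Ψ : ℝ → ℝ := fun t => A + c * ∫ s in a..t, φ s with hΨ
  have hΨc : ContinuousOn Ψ (Icc a b) := by
    have := intervalIntegral.continuousOn_primitive_interval' hφ left_mem_uIcc
    rw [uIcc_of_le hab] at this
    exact continuousOn_const.add (continuousOn_const.mul this)
  have hφt : ∀ t ∈ Icc a b, IntervalIntegrable φ volume a t := fun t ht =>
    hφ.mono_set (by rw [uIcc_of_le hab, uIcc_of_le ht.1]; exact Icc_subset_Icc_right ht.2)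
  have hΨi : IntervalIntegrable Ψ volume a b :=
    ContinuousOn.intervalIntegrable (by rwa [uIcc_of_le hab])
  have hΨt : ∀ t ∈ Icc a b, IntervalIntegrable Ψ volume a t := fun t ht =>
    hΨi.mono_set (by rw [uIcc_of_le hab, uIcc_of_le ht.1]; exact Icc_subset_Icc_right ht.2)
  -- Since φ is only integrable, its bound Ψ is only continuous. Iterating once more gives R ≥ Ψ
  -- with R' = cΨ ≤ cR, and the classical argument applies to R.
  set R : ℝ → ℝ := fun t => A + c * ∫ s in a..t, Ψ s with hR
  have hΨR : ∀ t ∈ Icc a b, Ψ t ≤ R t := by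
    intro t ht
    refine add_le_add le_rfl (mul_le_mul_of_nonneg_left ?_ hc)
    exact intervalIntegral.integral_mono_on ht.1 (hφt t ht) (hΨt t ht) fun s hs =>
      h s ⟨hs.1, hs.2.trans ht.2⟩
  have hRc : ContinuousOn R (Icc a b) := by
    have := intervalIntegral.continuousOn_primitive_interval' hΨi left_mem_uIcc
    rw [uIcc_of_le hab] at this
    exact continuousOn_const.add (continuousOn_const.mul this)
  have hRd : ∀ t ∈ Ioo a b, HasDerivAt R (c * Ψ t) t := by
    intro t ht
    have hct : ContinuousAt Ψ t := hΨc.continuousAt (Icc_mem_nhds ht.1 ht.2)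
    have := intervalIntegral.integral_hasDerivAt_right (hΨt t ⟨ht.1.le, ht.2.le⟩)
      (hΨc.stronglyMeasurableAtFilter_nhdsWithin measurableSet_Icc t |>.filter_mono (by
        rw [nhdsWithin_eq_nhds.2 (Icc_mem_nhds ht.1 ht.2)])) hct
    exact (this.const_mul c).const_add A
  have hanti : AntitoneOn (fun t => R t * Real.exp (-(c * (t - a)))) (Icc a b) := by
    refine antitoneOn_of_deriv_nonpos (convex_Icc a b) ?_ ?_ ?_
    · exact hRc.mul (by fun_prop)
    · intro t ht
      rw [interior_Icc] at ht
      exact ((hRd t ht).differentiableAt.mul (by fun_prop)).differentiableWithinAt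
    · intro t ht
      rw [interior_Icc] at ht
      have h1 : HasDerivAt (fun t => Real.exp (-(c * (t - a))))
          (Real.exp (-(c * (t - a))) * (-(c * 1))) t :=
        ((((hasDerivAt_id t).sub_const a).const_mul c).neg).exp
      rw [show deriv (fun t => R t * Real.exp (-(c * (t - a)))) t = _ from
        ((hRd t ht).mul h1).deriv]
      have h2 := hΨR t ⟨ht.1.le, ht.2.le⟩
      have h3 : c * Ψ t * Real.exp (-(c * (t - a))) + R t *
        (Real.exp (-(c * (t - a))) * (-(c * 1)))
          = (c * (Ψ t - R t)) * Real.exp (-(c * (t - a))) := by ring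
      rw [h3]
      exact mul_nonpos_of_nonpos_of_nonneg
        (mul_nonpos_of_nonneg_of_nonpos hc (by linarith)) (Real.exp_pos _).le
  have hb : b ∈ Icc a b := ⟨hab, le_rfl⟩
  have := hanti ⟨le_rfl, hab⟩ hb hab
  simp only [hR, sub_self, mul_zero, neg_zero, Real.exp_zero, mul_one,
    intervalIntegral.integral_same, add_zero] at this
  calc φ b ≤ Ψ b := h b hb
    _ ≤ R b := hΨR b hb
    _ = (R b * Real.exp (-(c * (b - a)))) * Real.exp (c * (b - a)) := by
      rw [mul_assoc, ← Real.exp_add]; simp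
    _ ≤ A * Real.exp (c * (b - a)) := mul_le_mul_of_nonneg_right this (Real.exp_pos _).le

/-! ### Pointwise algebra of the trilinear form and of gradients. -/

section Algebra

/-- The trilinear expression `∑ᵢⱼ uᵢ Gᵢⱼ wⱼ`. -/
noncomputable def tri (u : E3) (G : Mat3) (w : E3) : ℝ := ∑ i, ∑ j, u i * G (i, j) * w j

/-- Cauchy–Schwarz against the rank-one matrix u ⊗ w, whose Hilbert–Schmidt norm is |u||w|. -/
theorem abs_tri_le (u : E3) (G : Mat3) (w : E3) : |tri u G w| ≤ ‖u‖ * ‖G‖ * ‖w‖ := by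
  let T : Mat3 := WithLp.toLp 2 fun p => u p.1 * w p.2
  have hT : ‖T‖ = ‖u‖ * ‖w‖ := by
    rw [← sq_eq_sq₀ (norm_nonneg _) (by positivity), mul_pow, EuclideanSpace.norm_sq_eq,
      EuclideanSpace.norm_sq_eq, EuclideanSpace.norm_sq_eq, Fintype.sum_prod_type,
      Finset.sum_mul_sum]
    simp [T, mul_pow]
  have h1 : tri u G w = ⟪G, T⟫ := by
    simp only [tri, PiLp.inner_apply, Fintype.sum_prod_type, T]
    refine Finset.sum_congr rfl fun i _ => Finset.sum_congr rfl fun j _ => ?_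
    simp only [RCLike.inner_apply, conj_trivial]; ring
  rw [h1]
  calc |⟪G, T⟫| ≤ ‖G‖ * ‖T‖ := abs_real_inner_le_norm _ _
    _ = _ := by rw [hT]; ring

theorem tri_add_left (u u' : E3) (G : Mat3) (w : E3) : tri (u + u') G w = tri u G w + tri u' G w := by
  simp [tri, add_mul, Finset.sum_add_distrib]

theorem tri_add_middle (u : E3) (G G' : Mat3) (w : E3) :
    tri u (G + G') w = tri u G w + tri u G' w := by
  simp [tri, mul_add, add_mul, Finset.sum_add_distrib]

theorem tri_add_right (u : E3) (G : Mat3) (w w' : E3) :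
    tri u G (w + w') = tri u G w + tri u G w' := by
  simp [tri, mul_add, Finset.sum_add_distrib]

theorem tri_smul_left (c : ℝ) (u : E3) (G : Mat3) (w : E3) : tri (c • u) G w = c * tri u G w := by
  simp [tri, Finset.mul_sum, mul_assoc]

theorem tri_smul_middle (c : ℝ) (u : E3) (G : Mat3) (w : E3) :
    tri u (c • G) w = c * tri u G w := by
  simp only [tri, Finset.mul_sum, PiLp.smul_apply, smul_eq_mul]
  exact Finset.sum_congr rfl fun i _ => Finset.sum_congr rfl fun j _ => by ring

theorem tri_smul_right (c : ℝ) (u : E3) (G : Mat3) (w : E3) :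
    tri u G (c • w) = c * tri u G w := by
  simp only [tri, Finset.mul_sum, PiLp.smul_apply, smul_eq_mul]
  exact Finset.sum_congr rfl fun i _ => Finset.sum_congr rfl fun j _ => by ring

/-- The operator norm of the derivative is bounded by the Hilbert-Schmidt norm. -/
theorem norm_fderiv_le_norm_grad (φ : E3 → E3) (x : E3) : ‖fderiv ℝ φ x‖ ≤ ‖grad φ x‖ := by
  refine ContinuousLinearMap.opNorm_le_bound _ (norm_nonneg _) fun v => ?_
  set y := fderiv ℝ φ x v with hy
  -- The trilinear form with arguments v and y = Dφ(x)v returns |y|², so the bound on it gives |y|²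
  -- ≤ |v||∇φ||y|, from which one factor |y| is cancelled.
  have h1 : tri v (grad φ x) y = ‖y‖ ^ 2 := by
    have hv : y = ∑ i, v i • fderiv ℝ φ x (EuclideanSpace.single i (1 : ℝ)) := by
      have hve : v = ∑ i, v i • EuclideanSpace.single i (1 : ℝ) := by
        ext j; simp [Finset.sum_apply, Pi.single_apply]
      conv_lhs => rw [hy, hve, map_sum]
      simp
    have hyj : ∀ j, y j = ∑ i, v i * grad φ x (i, j) := by
      intro j
      rw [hv]; simp [grad]
    rw [EuclideanSpace.norm_sq_eq, tri, Finset.sum_comm]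
    refine Finset.sum_congr rfl fun j _ => ?_
    rw [← Finset.sum_mul, ← hyj, Real.norm_eq_abs, sq_abs, sq]
  have h2 := (le_abs_self _).trans (abs_tri_le v (grad φ x) y)
  rw [h1] at h2
  rcases (norm_nonneg y).eq_or_lt with h0 | h0
  · rw [← h0]; positivity
  · refine le_of_mul_le_mul_right ?_ h0
    nlinarith

theorem grad_add {φ χ : E3 → E3} (hφ : Differentiable ℝ φ) (hχ : Differentiable ℝ χ) :
    grad (φ + χ) = grad φ + grad χ := by
  ext x p
  simp [grad, fderiv_add (hφ x) (hχ x)]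

theorem grad_smul (c : ℝ) {φ : E3 → E3} (hφ : Differentiable ℝ φ) :
    grad (c • φ) = c • grad φ := by
  ext x p
  simp [grad, fderiv_const_smul (hφ x) c]

theorem support_grad_subset (φ : E3 → E3) : Function.support (grad φ) ⊆ tsupport φ := by
  intro x hx
  by_contra hc
  refine hx ?_
  ext p
  have : fderiv ℝ φ x = 0 := by
    by_contra h
    exact hc (support_fderiv_subset ℝ h)
  simp [grad, this]

end Algebra

/-! ### Test fields and the inclusion of V in H. -/

variable {Ω : Set E3}

namespace IsSolenoidalTest

variable {φ χ : E3 → E3}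

theorem differentiable (hφ : IsSolenoidalTest Ω φ) : Differentiable ℝ φ :=
  hφ.smooth.differentiable (by simp)

theorem zero : IsSolenoidalTest Ω (0 : E3 → E3) where
  smooth := contDiff_const
  compact_support := HasCompactSupport.zero
  support_subset := by simp
  div_free x := by simp [grad]

theorem add (hφ : IsSolenoidalTest Ω φ) (hχ : IsSolenoidalTest Ω χ) :
    IsSolenoidalTest Ω (φ + χ) where
  smooth := hφ.smooth.add hχ.smooth
  compact_support := hφ.compact_support.add hχ.compact_support
  support_subset := (tsupport_add φ χ).trans (union_subset hφ.support_subset hχ.support_subset)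
  div_free x := by
    rw [grad_add hφ.differentiable hχ.differentiable]
    simp [Finset.sum_add_distrib, hφ.div_free x, hχ.div_free x]

theorem smul (c : ℝ) (hφ : IsSolenoidalTest Ω φ) : IsSolenoidalTest Ω (c • φ) where
  smooth := contDiff_const.smul hφ.smooth
  compact_support := hφ.compact_support.smul_left (f := fun _ => c)
  support_subset := (tsupport_smul_subset_right (fun _ => c) φ).trans hφ.support_subset
  div_free x := by
    rw [grad_smul c hφ.differentiable]
    simp [← Finset.mul_sum, hφ.div_free x]

end IsSolenoidalTest

/-- An element of `V` that is represented by a test field. -/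
def IsTestField (U : V Ω) : Prop :=
  ∃ φ, IsSolenoidalTest Ω φ ∧ fieldV U =ᵐ[volume.restrict Ω] φ ∧
    gradV U =ᵐ[volume.restrict Ω] grad φ

/-- Test fields form a vector space, so the span in the definition of `V` adds nothing and single
test fields are already dense. Identities and bounds on V are obtained from them by continuity. -/
theorem dense_isTestField : Dense {U : V Ω | IsTestField U} := by
  set S : Set (WithLp 2 (L2 Ω × L2Mat Ω)) := {p | ∃ φ, IsSolenoidalTest Ω φ ∧
    p.fst =ᵐ[volume.restrict Ω] φ ∧ p.snd =ᵐ[volume.restrict Ω] grad φ} with hS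
  have hspan : ∀ p ∈ Submodule.span ℝ S, p ∈ S := by
    intro p hp
    induction hp using Submodule.span_induction with
    | mem p hp => exact hp
    | zero =>
      refine ⟨0, IsSolenoidalTest.zero, Lp.coeFn_zero _ _ _, ?_⟩
      have : grad (0 : E3 → E3) = 0 := by ext x p; simp [grad]
      rw [this]
      exact Lp.coeFn_zero _ _ _
    | add p q _ _ hp hq =>
      obtain ⟨φ, hφ, h1, h2⟩ := hp
      obtain ⟨χ, hχ, h3, h4⟩ := hq
      refine ⟨φ + χ, hφ.add hχ, ?_, ?_⟩
      · exact (Lp.coeFn_add p.fst q.fst).trans (h1.add h3)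
      · rw [grad_add hφ.differentiable hχ.differentiable]
        exact (Lp.coeFn_add p.snd q.snd).trans (h2.add h4)
    | smul c p _ hp =>
      obtain ⟨φ, hφ, h1, h2⟩ := hp
      refine ⟨c • φ, hφ.smul c, ?_, ?_⟩
      · exact (Lp.coeFn_smul c p.fst).trans (h1.const_smul c)
      · rw [grad_smul c hφ.differentiable]
        exact (Lp.coeFn_smul c p.snd).trans (h2.const_smul c)
  intro U
  rw [closure_subtype]
  refine closure_mono ?_ U.2
  intro p hp
  exact ⟨⟨p, subset_closure hp⟩, hspan p hp, rfl⟩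

/-- The inclusion of `V` in `(L²(Ω))³`. -/
noncomputable def fieldL : V Ω →L[ℝ] L2 Ω := (WithLp.fstL 2 ℝ (L2 Ω) (L2Mat Ω)).comp (V Ω).subtypeL

/-- The gradient as a map from `V` to `(L²(Ω))^{3 × 3}`. -/
noncomputable def gradL : V Ω →L[ℝ] L2Mat Ω := (WithLp.sndL 2 ℝ (L2 Ω) (L2Mat Ω)).comp (V Ω).subtypeL

theorem fieldV_mem_H (U : V Ω) : fieldV U ∈ H Ω := by
  have h := dense_isTestField (Ω := Ω) U
  have : fieldL U ∈ closure (fieldL '' {U : V Ω | IsTestField U}) :=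
    fieldL.continuous.continuousWithinAt.mem_closure_image h
  refine closure_mono ?_ this
  rintro _ ⟨W, ⟨φ, hφ, h1, -⟩, rfl⟩
  exact Submodule.subset_span ⟨φ, hφ, h1⟩

/-- The inclusion of `V` in `H`. -/
noncomputable def inclH : V Ω →L[ℝ] H Ω := fieldL.codRestrict (H Ω) fieldV_mem_H

theorem coe_inclH (U : V Ω) : (inclH U : L2 Ω) = fieldV U := rfl

theorem norm_sq_V (U : V Ω) : ‖U‖ ^ 2 = ‖fieldV U‖ ^ 2 + normV U ^ 2 :=
  WithLp.prod_norm_sq_eq_of_L2 (U : WithLp 2 (L2 Ω × L2Mat Ω))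

theorem normV_nonneg (U : V Ω) : 0 ≤ normV U := norm_nonneg _

theorem normV_le_norm (U : V Ω) : normV U ≤ ‖U‖ := by
  refine le_of_sq_le_sq ?_ (norm_nonneg _)
  rw [norm_sq_V]; nlinarith [sq_nonneg ‖fieldV U‖]

theorem norm_fieldV_le_norm (U : V Ω) : ‖fieldV U‖ ≤ ‖U‖ := by
  refine le_of_sq_le_sq ?_ (norm_nonneg _)
  rw [norm_sq_V]; nlinarith [sq_nonneg (normV U)]

theorem continuous_normV : Continuous (normV : V Ω → ℝ) := gradL.continuous.norm

/-! ### Sobolev and Poincaré inequalities on V. -/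

/-- `K` bounds the volume of `Ω` and the constants of the Sobolev inequality `V ⊂ L⁶` and of the
Poincaré inequality. -/
structure IsSobolevConst (Ω : Set E3) (K : ℝ) : Prop where
  one_le : 1 ≤ K
  volume_le : volume Ω ≤ ENNReal.ofReal K
  eLpNorm_six_le : ∀ U : V Ω, eLpNorm (fieldV U) 6 (volume.restrict Ω) ≤
    ENNReal.ofReal (K * normV U)
  norm_le : ∀ U : V Ω, ‖fieldV U‖ ≤ K * normV U

/-- Gagliardo–Nirenberg–Sobolev on ℝ³ with exponents 2 and 6. The support of the test field lies in
Ω, so the gradient norms over ℝ³ and over Ω agree. -/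
theorem eLpNorm_six_le_of_isTestField {U : V Ω} (hU : IsTestField U) :
    eLpNorm (fieldV U) 6 (volume.restrict Ω) ≤
      SNormLESNormFDerivOfEqConst E3 (volume : Measure E3) 2 * ENNReal.ofReal (normV U) := by
  obtain ⟨φ, hφ, h1, h2⟩ := hU
  have hS := eLpNorm_le_eLpNorm_fderiv_of_eq (volume : Measure E3) (u := φ)
    (hφ.smooth.of_le (by simp)) hφ.compact_support (p := 2) (p' := 6) (by norm_num) (by simp)
    (by simp; norm_num)
  calc eLpNorm (fieldV U) 6 (volume.restrict Ω) = eLpNorm φ 6 (volume.restrict Ω) :=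
        eLpNorm_congr_ae h1
    _ ≤ eLpNorm φ 6 volume := eLpNorm_restrict_le _ _ _ _
    _ ≤ SNormLESNormFDerivOfEqConst E3 (volume : Measure E3) 2 *
        eLpNorm (fderiv ℝ φ) 2 volume := by simpa using hS
    _ ≤ SNormLESNormFDerivOfEqConst E3 (volume : Measure E3) 2 * eLpNorm (grad φ) 2 volume := by
      gcongr
      exact eLpNorm_mono (norm_fderiv_le_norm_grad φ)
    _ = SNormLESNormFDerivOfEqConst E3 (volume : Measure E3) 2 *
        ENNReal.ofReal (normV U) := by
      congr 1
      rw [← eLpNorm_restrict_eq_of_support_subset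
        ((support_grad_subset φ).trans hφ.support_subset), ← eLpNorm_congr_ae h2, normV,
        Lp.norm_def, ENNReal.ofReal_toReal (Lp.eLpNorm_ne_top _)]

/-- Approximating test fields converge in L², hence almost everywhere along a subsequence. Fatou's
lemma passes the L⁶ bound to the limit. -/
theorem eLpNorm_six_le (U : V Ω) :
    eLpNorm (fieldV U) 6 (volume.restrict Ω) ≤
      SNormLESNormFDerivOfEqConst E3 (volume : Measure E3) 2 * ENNReal.ofReal (normV U) := by
  obtain ⟨p, hp, hlim⟩ := mem_closure_iff_seq_limit.1 (dense_isTestField (Ω := Ω) U)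
  have hf : Tendsto (fun n => fieldV (p n)) atTop (𝓝 (fieldV U)) :=
    (fieldL.continuous.tendsto U).comp hlim
  have hm : TendstoInMeasure (volume.restrict Ω) (fun n => (fieldV (p n) : E3 → E3)) atTop
      (fieldV U) := tendstoInMeasure_of_tendsto_Lp hf
  obtain ⟨ns, hns, hae⟩ := hm.exists_seq_tendsto_ae
  refine (Lp.eLpNorm_lim_le_liminf_eLpNorm (p := 6)
    (fun n => Lp.aestronglyMeasurable (fieldV (p (ns n)))) _ hae).trans ?_
  have hg : Tendsto (fun n => (SNormLESNormFDerivOfEqConst E3 (volume : Measure E3) 2 : ENNReal) *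
      ENNReal.ofReal (normV (p (ns n)))) atTop
      (𝓝 (SNormLESNormFDerivOfEqConst E3 (volume : Measure E3) 2 * ENNReal.ofReal (normV U))) := by
    refine ENNReal.Tendsto.const_mul (ENNReal.tendsto_ofReal ?_) (Or.inr ENNReal.coe_ne_top)
    exact (continuous_normV.tendsto U).comp (hlim.comp hns.tendsto_atTop)
  rw [← hg.liminf_eq]
  exact liminf_le_liminf (Eventually.of_forall fun n => eLpNorm_six_le_of_isTestField (hp _))

/-- Poincaré comes from Sobolev: on a set of finite volume, Hölder gives |u|₂ ≤ |Ω|^(1/3)|u|₆. One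
constant dominating 1, |Ω| and both inequality constants keeps later estimates in powers of K. -/
theorem exists_isSobolevConst (hb : Bornology.IsBounded Ω) : ∃ K, IsSobolevConst Ω K := by
  set S : ℝ := ((SNormLESNormFDerivOfEqConst E3 (volume : Measure E3) 2 : NNReal) : ℝ) with hS
  have hS0 : 0 ≤ S := NNReal.coe_nonneg _
  have hvol : volume Ω ≠ ⊤ := hb.measure_lt_top.ne
  set v : ℝ := (volume Ω).toReal with hv
  have hv0 : 0 ≤ v := ENNReal.toReal_nonneg
  set m : ℝ := v ^ ((1 : ℝ) / 3) with hm
  have hm0 : 0 ≤ m := Real.rpow_nonneg hv0 _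
  have h6 : ∀ U : V Ω, eLpNorm (fieldV U) 6 (volume.restrict Ω) ≤ ENNReal.ofReal (S * normV U) := by
    intro U
    rw [ENNReal.ofReal_mul hS0, hS, ENNReal.ofReal_coe_nnreal]
    exact eLpNorm_six_le U
  refine ⟨1 + v + S + S * m, ?_, ?_, fun U => (h6 U).trans ?_, fun U => ?_⟩
  · nlinarith [mul_nonneg hS0 hm0]
  · rw [← ENNReal.ofReal_toReal hvol]
    exact ENNReal.ofReal_le_ofReal (by nlinarith [mul_nonneg hS0 hm0])
  · refine ENNReal.ofReal_le_ofReal (mul_le_mul_of_nonneg_right ?_ (normV_nonneg U))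
    nlinarith [mul_nonneg hS0 hm0]
  · have h2 := eLpNorm_le_eLpNorm_mul_rpow_measure_univ (μ := volume.restrict Ω) (p := 2) (q := 6)
      (by norm_num) (Lp.aestronglyMeasurable (fieldV U))
    have h3 : eLpNorm (fieldV U) 2 (volume.restrict Ω) ≤ ENNReal.ofReal (S * normV U * m) := by
      refine h2.trans ?_
      rw [ENNReal.ofReal_mul (mul_nonneg hS0 (normV_nonneg U)), hm,
        ← ENNReal.ofReal_rpow_of_nonneg hv0 (by norm_num), hv, ENNReal.ofReal_toReal hvol,
        Measure.restrict_apply_univ]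
      refine mul_le_mul' (h6 U) (le_of_eq ?_)
      norm_num
    rw [Lp.norm_def]
    refine (ENNReal.toReal_le_of_le_ofReal ?_ h3).trans ?_
    · exact mul_nonneg (mul_nonneg hS0 (normV_nonneg U)) hm0
    · nlinarith [mul_nonneg hS0 hm0, normV_nonneg U, mul_nonneg hv0 (normV_nonneg U),
        mul_nonneg hS0 (normV_nonneg U)]

/-! ### Hölder inequalities for the convection and the damping. -/

section Holder

variable {α E F : Type*} [MeasurableSpace α] {μ : Measure α} [NormedAddCommGroup E]
  [NormedAddCommGroup F]

theorem lintegral_enorm_rpow_rpow (f : α → E) {p : ENNReal} (hp0 : p ≠ 0) (hp : p ≠ ⊤) (w : ℝ) :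
    (∫⁻ x, ‖f x‖ₑ ^ p.toReal ∂μ) ^ (w / p.toReal) = eLpNorm f p μ ^ w := by
  rw [eLpNorm_eq_lintegral_rpow_enorm_toReal hp0 hp, ← ENNReal.rpow_mul]
  congr 1; ring

/-- Hölder with exponents 6, 2, 3, the L³ norm of c being interpolated between L² and L⁶ by
splitting |c| into two square roots. The four weights are 1/6, 1/2, 1/4 and 1/12. -/
theorem lintegral_mul_mul_le {a c : α → E} {B : α → F} (ha : AEStronglyMeasurable a μ)
    (hB : AEStronglyMeasurable B μ) (hc : AEStronglyMeasurable c μ) :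
    ∫⁻ x, ‖a x‖ₑ * ‖B x‖ₑ * ‖c x‖ₑ ∂μ ≤ eLpNorm a 6 μ * eLpNorm B 2 μ *
      (eLpNorm c 2 μ ^ (1 / 2 : ℝ) * eLpNorm c 6 μ ^ (1 / 2 : ℝ)) := by
  have h := ENNReal.lintegral_prod_norm_pow_le (μ := μ) (Finset.univ : Finset (Fin 4))
    (f := ![fun x => ‖a x‖ₑ ^ (6 : ENNReal).toReal, fun x => ‖B x‖ₑ ^ (2 : ENNReal).toReal,
      fun x => ‖c x‖ₑ ^ (2 : ENNReal).toReal, fun x => ‖c x‖ₑ ^ (6 : ENNReal).toReal])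
    (p := ![1 / (6 : ENNReal).toReal, 1 / (2 : ENNReal).toReal, (1 / 2) / (2 : ENNReal).toReal,
      (1 / 2) / (6 : ENNReal).toReal])
    (by
      intro i _
      fin_cases i
      · exact ha.enorm.pow_const _
      · exact hB.enorm.pow_const _
      · exact hc.enorm.pow_const _
      · exact hc.enorm.pow_const _)
    (by simp [Fin.sum_univ_four]; norm_num)
    (by intro i _; fin_cases i <;> simp <;> norm_num)
  simp only [Fin.prod_univ_four, Matrix.cons_val] at h
  rw [lintegral_enorm_rpow_rpow a (by simp) (by simp), lintegral_enorm_rpow_rpow B (by simp)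
    (by simp), lintegral_enorm_rpow_rpow c (by simp) (by simp),
    lintegral_enorm_rpow_rpow c (by simp) (by simp), ENNReal.rpow_one, ENNReal.rpow_one] at h
  rw [← mul_assoc]
  refine le_trans (le_of_eq (lintegral_congr fun x => ?_)) h
  simp only [← ENNReal.rpow_mul]
  rw [mul_assoc (_ * _), ← ENNReal.rpow_add_of_nonneg _ _ (by positivity) (by positivity)]
  norm_num

/-- The weights s/6, 1/6, 1/2 leave (2-s)/6, which is spent on the constant function 1. Its
nonnegativity is the condition s ≤ 2, that is β ≤ 3. -/
theorem lintegral_rpow_mul_mul_le {s : ℝ} (hs0 : 0 ≤ s) (hs2 : s ≤ 2) {p : α → ℝ} {q z : α → E}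
    (hp : AEStronglyMeasurable p μ) (hq : AEStronglyMeasurable q μ)
    (hz : AEStronglyMeasurable z μ) :
    ∫⁻ x, ‖p x‖ₑ ^ s * ‖q x‖ₑ * ‖z x‖ₑ ∂μ ≤ eLpNorm p 6 μ ^ s * eLpNorm q 6 μ *
      eLpNorm z 2 μ * μ univ ^ ((2 - s) / 6) := by
  have h := ENNReal.lintegral_prod_norm_pow_le (μ := μ) (Finset.univ : Finset (Fin 4))
    (f := ![fun x => ‖p x‖ₑ ^ (6 : ENNReal).toReal, fun x => ‖q x‖ₑ ^ (6 : ENNReal).toReal,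
      fun x => ‖z x‖ₑ ^ (2 : ENNReal).toReal, fun _ => 1])
    (p := ![s / (6 : ENNReal).toReal, 1 / (6 : ENNReal).toReal, 1 / (2 : ENNReal).toReal,
      (2 - s) / 6])
    (by
      intro i _
      fin_cases i
      · exact hp.enorm.pow_const _
      · exact hq.enorm.pow_const _
      · exact hz.enorm.pow_const _
      · exact aemeasurable_const)
    (by simp [Fin.sum_univ_four]; ring)
    (by
      intro i _
      fin_cases i
      · simpa using by positivity
      · simp
      · simp
      · simpa using by linarith)
  simp only [Fin.prod_univ_four, Matrix.cons_val] at h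
  rw [lintegral_enorm_rpow_rpow p (by simp) (by simp), lintegral_enorm_rpow_rpow q (by simp)
    (by simp), lintegral_enorm_rpow_rpow z (by simp) (by simp), ENNReal.rpow_one,
    ENNReal.rpow_one, lintegral_const, one_mul] at h
  refine le_trans (le_of_eq (lintegral_congr fun x => ?_)) h
  simp only [← ENNReal.rpow_mul, ENNReal.one_rpow, mul_one]
  congr 2
  · congr 1; simp only [ENNReal.toReal_ofNat]; ring
  · norm_num
  · norm_num

theorem integrable_and_abs_integral_le {f : α → ℝ} (hf : AEStronglyMeasurable f μ) {c : ℝ}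
    (hc : 0 ≤ c) (h : ∫⁻ x, ‖f x‖ₑ ∂μ ≤ ENNReal.ofReal c) :
    Integrable f μ ∧ |∫ x, f x ∂μ| ≤ c := by
  refine ⟨⟨hf, h.trans_lt ENNReal.ofReal_lt_top⟩, ?_⟩
  have h1 := (enorm_integral_le_lintegral_enorm f).trans h
  rwa [← ofReal_norm, ENNReal.ofReal_le_ofReal_iff hc] at h1

end Holder

/-! ### Pointwise inequalities for the power nonlinearity. -/

section Pointwise

/-- By homogeneity set q = p/r ≤ 1. Then 1 - q^s ≤ 1 - q² ≤ 2(1 - q), the first step because s ≤ 2.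
-/
theorem mul_rpow_sub_rpow_le {s p r : ℝ} (hs0 : 0 ≤ s) (hs2 : s ≤ 2) (hp : 0 ≤ p) (hpr : p ≤ r) :
    r * (r ^ s - p ^ s) ≤ 2 * r ^ s * (r - p) := by
  rcases (hp.trans hpr).eq_or_lt with h0 | h0
  · rw [← h0]
    have : p = 0 := le_antisymm (hpr.trans h0.symm.le) hp
    simp [this]
  set q := p / r with hq
  have hq0 : 0 ≤ q := div_nonneg hp h0.le
  have hq1 : q ≤ 1 := (div_le_one h0).2 hpr
  have hpq : p = r * q := by rw [hq]; field_simp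
  have h1 : q ^ (2 : ℝ) ≤ q ^ s := Real.rpow_le_rpow_of_exponent_ge' hq0 hq1 hs0 hs2
  rw [Real.rpow_two] at h1
  have hr := Real.rpow_nonneg h0.le s
  rw [hpq, Real.mul_rpow h0.le hq0]
  have h2 : 0 ≤ r * r ^ s := mul_nonneg h0.le hr
  have h3 : 1 - q ^ s ≤ 2 * (1 - q) := by nlinarith [sq_nonneg (q - 1)]
  nlinarith [mul_le_mul_of_nonneg_left h3 h2]

/-- The damping nonlinearity `|a|^s a`. -/
noncomputable def damp (s : ℝ) (a : E3) : E3 := ‖a‖ ^ s • a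

theorem norm_damp (s : ℝ) (a : E3) : ‖damp s a‖ = ‖a‖ ^ s * ‖a‖ := by
  rw [damp, norm_smul, Real.norm_of_nonneg (Real.rpow_nonneg (norm_nonneg _) _)]

theorem continuous_damp {s : ℝ} (hs : 0 ≤ s) : Continuous (damp s) :=
  (continuous_norm.rpow_const fun _ => Or.inr hs).smul continuous_id

theorem norm_damp_sub_le {s : ℝ} (hs0 : 0 ≤ s) (hs2 : s ≤ 2) (a b : E3) :
    ‖damp s a - damp s b‖ ≤ 3 * ((‖a‖ + ‖b‖) ^ s * ‖a - b‖) := by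
  have main : ∀ a b : E3, ‖b‖ ≤ ‖a‖ → ‖damp s a - damp s b‖ ≤ 3 * (‖a‖ ^ s * ‖a - b‖) := by
    intro a b hab
    have h1 : damp s a - damp s b = ‖a‖ ^ s • (a - b) + (‖a‖ ^ s - ‖b‖ ^ s) • b := by
      simp only [damp, smul_sub, sub_smul]; abel
    have hmono : ‖b‖ ^ s ≤ ‖a‖ ^ s := Real.rpow_le_rpow (norm_nonneg _) hab hs0
    have h2 : (‖a‖ ^ s - ‖b‖ ^ s) * ‖b‖ ≤ 2 * ‖a‖ ^ s * ‖a - b‖ := by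
      calc (‖a‖ ^ s - ‖b‖ ^ s) * ‖b‖ ≤ (‖a‖ ^ s - ‖b‖ ^ s) * ‖a‖ :=
            mul_le_mul_of_nonneg_left hab (by linarith)
        _ ≤ 2 * ‖a‖ ^ s * (‖a‖ - ‖b‖) := by
            rw [mul_comm]; exact mul_rpow_sub_rpow_le hs0 hs2 (norm_nonneg _) hab
        _ ≤ 2 * ‖a‖ ^ s * ‖a - b‖ := mul_le_mul_of_nonneg_left (norm_sub_norm_le _ _)
            (by positivity)
    rw [h1]
    refine (norm_add_le _ _).trans ?_
    rw [norm_smul, norm_smul, Real.norm_of_nonneg (by positivity),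
      Real.norm_of_nonneg (by linarith)]
    linarith
  rcases le_total ‖b‖ ‖a‖ with h | h
  · refine (main a b h).trans ?_
    gcongr
    linarith [norm_nonneg b]
  · rw [norm_sub_rev, norm_sub_rev a b]
    refine (main b a h).trans ?_
    gcongr
    linarith [norm_nonneg a]

/-- Cauchy–Schwarz on the cross term reduces monotonicity to the radial case, where r ↦ r^s r is
increasing on r ≥ 0. -/
theorem inner_damp_sub_nonneg {s : ℝ} (hs0 : 0 ≤ s) (a b : E3) :
    0 ≤ ⟪damp s a - damp s b, a - b⟫ := by
  have h1 : ⟪damp s a - damp s b, a - b⟫ = ‖a‖ ^ s * ‖a‖ ^ 2 + ‖b‖ ^ s * ‖b‖ ^ 2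
      - (‖a‖ ^ s + ‖b‖ ^ s) * ⟪a, b⟫ := by
    simp only [damp, inner_sub_left, inner_sub_right, real_inner_smul_left,
      real_inner_self_eq_norm_sq, real_inner_comm a b]
    ring
  have ha := Real.rpow_nonneg (norm_nonneg a) s
  have hb := Real.rpow_nonneg (norm_nonneg b) s
  have h2 := mul_le_mul_of_nonneg_left (real_inner_le_norm a b) (add_nonneg ha hb)
  have h3 : 0 ≤ (‖a‖ ^ s * ‖a‖ - ‖b‖ ^ s * ‖b‖) * (‖a‖ - ‖b‖) := by
    rcases le_total ‖b‖ ‖a‖ with h | h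
    · have := Real.rpow_le_rpow (norm_nonneg _) h hs0
      exact mul_nonneg (sub_nonneg.2 (mul_le_mul this h (norm_nonneg _) ha)) (sub_nonneg.2 h)
    · have := Real.rpow_le_rpow (norm_nonneg _) h hs0
      exact mul_nonneg_of_nonpos_of_nonpos
        (sub_nonpos.2 (mul_le_mul this h (norm_nonneg _) hb)) (sub_nonpos.2 h)
  rw [h1]
  nlinarith

end Pointwise

variable {K : ℝ}

/-! ### The convection term. -/

section Convection

theorem b_eq_integral_tri (U W Z : V Ω) :
    b U W Z = ∫ x in Ω, tri (fieldV U x) (gradV W x) (fieldV Z x) := rfl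

theorem aestronglyMeasurable_tri {u w : E3 → E3} {G : E3 → Mat3} {μ : Measure E3}
    (hu : AEStronglyMeasurable u μ) (hG : AEStronglyMeasurable G μ)
    (hw : AEStronglyMeasurable w μ) :
    AEStronglyMeasurable (fun x => tri (u x) (G x) (w x)) μ := by
  have h1 : ∀ i, AEStronglyMeasurable (fun x => u x i) μ := fun i =>
    (PiLp.continuous_apply 2 _ i).comp_aestronglyMeasurable hu
  have h2 : ∀ i, AEStronglyMeasurable (fun x => w x i) μ := fun i =>
    (PiLp.continuous_apply 2 _ i).comp_aestronglyMeasurable hw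
  have h3 : ∀ i, AEStronglyMeasurable (fun x => G x i) μ := fun i =>
    (PiLp.continuous_apply 2 _ i).comp_aestronglyMeasurable hG
  unfold tri
  exact Finset.aestronglyMeasurable_fun_sum _ fun i _ =>
    Finset.aestronglyMeasurable_fun_sum _ fun j _ => ((h1 i).mul (h3 (i, j))).mul (h2 j)

theorem IsSobolevConst.sqrt_le (hK : IsSobolevConst Ω K) : √K ≤ K :=
  Real.sqrt_le_iff.2 ⟨by linarith [hK.one_le], by nlinarith [hK.one_le]⟩

/-- The half power of |Z| is what lets the viscosity absorb this term when Z is the difference of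
two solutions. -/
theorem IsSobolevConst.tri_bound (hK : IsSobolevConst Ω K) (U W Z : V Ω) :
    Integrable (fun x => tri (fieldV U x) (gradV W x) (fieldV Z x)) (volume.restrict Ω) ∧
    |b U W Z| ≤ K ^ 2 * normV U * normV W * (√‖fieldV Z‖ * √(normV Z)) := by
  have hK0 : 0 ≤ K := by linarith [hK.one_le]
  have hU := normV_nonneg U
  have hW := normV_nonneg W
  have hZ := normV_nonneg Z
  rw [b_eq_integral_tri]
  refine integrable_and_abs_integral_le (aestronglyMeasurable_tri (Lp.aestronglyMeasurable _)
    (Lp.aestronglyMeasurable _) (Lp.aestronglyMeasurable _)) (by positivity) ?_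
  calc ∫⁻ x in Ω, ‖tri (fieldV U x) (gradV W x) (fieldV Z x)‖ₑ
      ≤ ∫⁻ x in Ω, ‖fieldV U x‖ₑ * ‖gradV W x‖ₑ * ‖fieldV Z x‖ₑ := by
        refine lintegral_mono fun x => ?_
        rw [← ofReal_norm, ← ofReal_norm, ← ofReal_norm, ← ofReal_norm,
          ← ENNReal.ofReal_mul (by positivity), ← ENNReal.ofReal_mul (by positivity)]
        exact ENNReal.ofReal_le_ofReal (abs_tri_le _ _ _)
    _ ≤ _ := lintegral_mul_mul_le (Lp.aestronglyMeasurable _) (Lp.aestronglyMeasurable _)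
        (Lp.aestronglyMeasurable _)
    _ ≤ ENNReal.ofReal (K * normV U) * ENNReal.ofReal (normV W) *
        (ENNReal.ofReal (√‖fieldV Z‖) * ENNReal.ofReal (√(K * normV Z))) := by
        have h2 : ∀ {E : Type} [NormedAddCommGroup E] (f : Lp E 2 (volume.restrict Ω)),
            eLpNorm f 2 (volume.restrict Ω) = ENNReal.ofReal ‖f‖ := fun f => by
          rw [Lp.norm_def, ENNReal.ofReal_toReal (Lp.eLpNorm_ne_top _)]
        rw [Real.sqrt_eq_rpow, Real.sqrt_eq_rpow,
          ← ENNReal.ofReal_rpow_of_nonneg (norm_nonneg _) (by norm_num),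
          ← ENNReal.ofReal_rpow_of_nonneg (by positivity) (by norm_num), h2, h2]
        gcongr
        · exact hK.eLpNorm_six_le U
        · exact le_rfl
        · exact hK.eLpNorm_six_le Z
    _ ≤ ENNReal.ofReal (K ^ 2 * normV U * normV W * (√‖fieldV Z‖ * √(normV Z))) := by
        rw [← ENNReal.ofReal_mul (by positivity), ← ENNReal.ofReal_mul (by positivity),
          ← ENNReal.ofReal_mul (by positivity)]
        refine ENNReal.ofReal_le_ofReal ?_
        rw [Real.sqrt_mul hK0]
        have h3 : K * normV U * normV W * (√‖fieldV Z‖ * (√K * √(normV Z)))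
            = (K * normV U * normV W * (√‖fieldV Z‖ * √(normV Z))) * √K := by ring
        have h4 : K ^ 2 * normV U * normV W * (√‖fieldV Z‖ * √(normV Z))
            = (K * normV U * normV W * (√‖fieldV Z‖ * √(normV Z))) * K := by ring
        rw [h3, h4]
        exact mul_le_mul_of_nonneg_left hK.sqrt_le (by positivity)

theorem IsSobolevConst.abs_b_le (hK : IsSobolevConst Ω K) (U W Z : V Ω) :
    |b U W Z| ≤ K ^ 3 * normV U * normV W * normV Z := by
  have hK0 : 0 ≤ K := by linarith [hK.one_le]
  have hU := normV_nonneg U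
  have hW := normV_nonneg W
  have hZ := normV_nonneg Z
  refine (hK.tri_bound U W Z).2.trans ?_
  have h1 : √‖fieldV Z‖ ≤ K * √(normV Z) := by
    refine (Real.sqrt_le_sqrt (hK.norm_le Z)).trans ?_
    rw [Real.sqrt_mul hK0]
    exact mul_le_mul_of_nonneg_right hK.sqrt_le (Real.sqrt_nonneg _)
  have h2 : √‖fieldV Z‖ * √(normV Z) ≤ K * normV Z := by
    calc √‖fieldV Z‖ * √(normV Z) ≤ (K * √(normV Z)) * √(normV Z) :=
          mul_le_mul_of_nonneg_right h1 (Real.sqrt_nonneg _)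
      _ = K * normV Z := by rw [mul_assoc, Real.mul_self_sqrt hZ]
  calc _ ≤ K ^ 2 * normV U * normV W * (K * normV Z) :=
        mul_le_mul_of_nonneg_left h2 (by positivity)
    _ = _ := by ring

theorem fieldV_add (U W : V Ω) :
    fieldV (U + W) =ᵐ[volume.restrict Ω] fun x => fieldV U x + fieldV W x :=
  Lp.coeFn_add (fieldV U) (fieldV W)

theorem fieldV_sub (U W : V Ω) :
    fieldV (U - W) =ᵐ[volume.restrict Ω] fun x => fieldV U x - fieldV W x :=
  Lp.coeFn_sub (fieldV U) (fieldV W)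

theorem fieldV_smul (c : ℝ) (U : V Ω) :
    fieldV (c • U) =ᵐ[volume.restrict Ω] fun x => c • fieldV U x :=
  Lp.coeFn_smul c (fieldV U)

theorem gradV_add (U W : V Ω) :
    gradV (U + W) =ᵐ[volume.restrict Ω] fun x => gradV U x + gradV W x :=
  Lp.coeFn_add (gradV U) (gradV W)

theorem gradV_smul (c : ℝ) (U : V Ω) :
    gradV (c • U) =ᵐ[volume.restrict Ω] fun x => c • gradV U x :=
  Lp.coeFn_smul c (gradV U)

theorem IsSobolevConst.b_add_left (hK : IsSobolevConst Ω K) (U U' W Z : V Ω) :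
    b (U + U') W Z = b U W Z + b U' W Z := by
  simp only [b_eq_integral_tri]
  rw [← integral_add (hK.tri_bound U W Z).1 (hK.tri_bound U' W Z).1]
  refine integral_congr_ae ?_
  filter_upwards [fieldV_add U U'] with x hx
  rw [hx, tri_add_left]

theorem IsSobolevConst.b_add_middle (hK : IsSobolevConst Ω K) (U W W' Z : V Ω) :
    b U (W + W') Z = b U W Z + b U W' Z := by
  simp only [b_eq_integral_tri]
  rw [← integral_add (hK.tri_bound U W Z).1 (hK.tri_bound U W' Z).1]
  refine integral_congr_ae ?_
  filter_upwards [gradV_add W W'] with x hx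
  rw [hx, tri_add_middle]

/-- The convection term `w ↦ b(u, v, w)` as an element of `V'`. -/
noncomputable def bDual (hK : IsSobolevConst Ω K) (U W : V Ω) : VDual Ω :=
  LinearMap.mkContinuous
    { toFun := fun Z => b U W Z
      map_add' := fun Z Z' => by
        simp only [b_eq_integral_tri]
        rw [← integral_add (hK.tri_bound U W Z).1 (hK.tri_bound U W Z').1]
        refine integral_congr_ae ?_
        filter_upwards [fieldV_add Z Z'] with x hx
        rw [hx, tri_add_right]
      map_smul' := fun c Z => by
        simp only [b_eq_integral_tri, RingHom.id_apply, smul_eq_mul]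
        rw [← integral_const_mul]
        refine integral_congr_ae ?_
        filter_upwards [fieldV_smul c Z] with x hx
        rw [hx, tri_smul_right] }
    (K ^ 3 * ‖U‖ * ‖W‖)
    (fun Z => by
      have hK0 : 0 ≤ K := by linarith [hK.one_le]
      refine (hK.abs_b_le U W Z).trans ?_
      have hW := normV_nonneg W
      have hZ := normV_nonneg Z
      gcongr
      · exact normV_le_norm U
      · exact normV_le_norm W
      · exact normV_le_norm Z)

theorem bDual_apply (hK : IsSobolevConst Ω K) (U W Z : V Ω) : bDual hK U W Z = b U W Z := rfl

theorem norm_bDual_le (hK : IsSobolevConst Ω K) (U W : V Ω) :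
    ‖bDual hK U W‖ ≤ K ^ 3 * ‖U‖ * ‖W‖ := by
  have hK0 : 0 ≤ K := by linarith [hK.one_le]
  exact LinearMap.mkContinuous_norm_le _ (by positivity) _

/-- The convection term as a continuous bilinear map into `V'`. -/
noncomputable def bForm (hK : IsSobolevConst Ω K) : V Ω →L[ℝ] V Ω →L[ℝ] VDual Ω :=
  LinearMap.mkContinuous₂
    (LinearMap.mk₂ ℝ (bDual hK)
      (fun U U' W => by
        ext Z
        simp only [bDual_apply, add_apply]
        exact hK.b_add_left U U' W Z)
      (fun c U W => by
        ext Z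
        simp only [bDual_apply, smul_apply, b_eq_integral_tri, smul_eq_mul]
        rw [← integral_const_mul]
        refine integral_congr_ae ?_
        filter_upwards [fieldV_smul c U] with x hx
        rw [hx, tri_smul_left])
      (fun U W W' => by
        ext Z
        simp only [bDual_apply, add_apply]
        exact hK.b_add_middle U W W' Z)
      (fun c U W => by
        ext Z
        simp only [bDual_apply, smul_apply, b_eq_integral_tri, smul_eq_mul]
        rw [← integral_const_mul]
        refine integral_congr_ae ?_
        filter_upwards [gradV_smul c W] with x hx
        rw [hx, tri_smul_middle]))
    (K ^ 3)
    (norm_bDual_le hK)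

theorem bForm_apply (hK : IsSobolevConst Ω K) (U W Z : V Ω) : bForm hK U W Z = b U W Z := rfl

theorem IsSolenoidalTest.contDiff_apply {φ : E3 → E3} (hφ : IsSolenoidalTest Ω φ) (j : Fin 3) :
    ContDiff ℝ ∞ fun x => φ x j := contDiff_euclidean.1 hφ.smooth j

theorem IsSolenoidalTest.grad_apply {φ : E3 → E3} (hφ : IsSolenoidalTest Ω φ) (i j : Fin 3)
    (x : E3) : grad φ x (i, j) =
      fderiv ℝ (fun x => φ x j) x (EuclideanSpace.single i (1 : ℝ)) := by
  have hd : HasFDerivAt φ (fderiv ℝ φ x) x := (hφ.differentiable x).hasFDerivAt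
  have := (PiLp.proj (𝕜 := ℝ) 2 (fun _ : Fin 3 => ℝ) j).hasFDerivAt.comp x hd
  have h' : fderiv ℝ (fun x => φ x j) x = _ := this.fderiv
  rw [h']; simp [grad]

theorem IsSolenoidalTest.continuous_grad_apply {φ : E3 → E3} (hφ : IsSolenoidalTest Ω φ)
    (i j : Fin 3) : Continuous fun x => grad φ x (i, j) := by
  simp_rw [hφ.grad_apply]
  exact ((hφ.contDiff_apply j).continuous_fderiv (by simp)).clm_apply continuous_const

theorem IsSolenoidalTest.integrable_mul_apply {χ : E3 → E3} (hχ : IsSolenoidalTest Ω χ)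
    {f : E3 → ℝ} (hf : Continuous f) (j : Fin 3) : Integrable fun x => f x * χ x j := by
  have hcs : HasCompactSupport fun x => χ x j :=
    hχ.compact_support.comp_left (g := fun y : E3 => y j) (by simp)
  exact (hf.mul (hχ.contDiff_apply j).continuous).integrable_of_hasCompactSupport hcs.mul_left

/-- Integration by parts in a component of the convection term. -/
theorem two_mul_integral_convection {φ χ : E3 → E3} (hφ : IsSolenoidalTest Ω φ)
    (hχ : IsSolenoidalTest Ω χ) (i j : Fin 3) :
    2 * ∫ x, φ x i * grad χ x (i, j) * χ x j = -∫ x, grad φ x (i, i) * χ x j * χ x j := by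
  have hφi := (hφ.contDiff_apply i).continuous
  have hχj := (hχ.contDiff_apply j).continuous
  have hdφ := (hφ.contDiff_apply i).differentiable (by simp)
  have hdχ := (hχ.contDiff_apply j).differentiable (by simp)
  have hgφ := hφ.continuous_grad_apply i i
  have hgχ := hχ.continuous_grad_apply i j
  have hprod : ∀ x, fderiv ℝ (fun x => φ x i * χ x j) x (EuclideanSpace.single i (1 : ℝ))
      = grad φ x (i, i) * χ x j + φ x i * grad χ x (i, j) := by
    intro x
    rw [fderiv_fun_mul (hdφ x) (hdχ x), hφ.grad_apply, hχ.grad_apply]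
    simp only [add_apply, smul_apply, smul_eq_mul]
    ring
  have i1 : Integrable fun x => fderiv ℝ (fun x => φ x i * χ x j) x
      (EuclideanSpace.single i (1 : ℝ)) * χ x j := by
    simp_rw [hprod]
    exact hχ.integrable_mul_apply ((hgφ.mul hχj).add (hφi.mul hgχ)) j
  have i2 : Integrable fun x => φ x i * χ x j * fderiv ℝ (fun x => χ x j) x
      (EuclideanSpace.single i (1 : ℝ)) := by
    simp_rw [← hχ.grad_apply]
    refine (hχ.integrable_mul_apply (hφi.mul hgχ) j).congr (Eventually.of_forall fun x => ?_)
    simp only [Pi.mul_apply]; ring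
  -- Moving ∂ᵢ off the second χⱼ onto φᵢχⱼ reproduces the original integral with the opposite sign,
  -- which accounts for the factor 2 in the statement.
  have hibp := integral_mul_fderiv_eq_neg_fderiv_mul_of_integrable (μ := (volume : Measure E3))
    (f := fun x => φ x i * χ x j) (g := fun x => χ x j) (v := EuclideanSpace.single i (1 : ℝ))
    i1 i2 (hχ.integrable_mul_apply (hφi.mul hχj) j) (fun x _ => (hdφ x).mul (hdχ x))
    (fun x _ => hdχ x)
  simp_rw [hprod, ← hχ.grad_apply, add_mul] at hibp
  have i3 : Integrable fun x => grad φ x (i, i) * χ x j * χ x j :=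
    hχ.integrable_mul_apply (hgφ.mul hχj) j
  have i4 : Integrable fun x => φ x i * grad χ x (i, j) * χ x j :=
    hχ.integrable_mul_apply (hφi.mul hgχ) j
  rw [integral_add i3 i4] at hibp
  have h1 : ∫ x, φ x i * χ x j * grad χ x (i, j) = ∫ x, φ x i * grad χ x (i, j) * χ x j :=
    integral_congr_ae (Eventually.of_forall fun x => by simp only; ring)
  rw [h1] at hibp
  linarith

theorem integral_tri_self_eq_zero {φ χ : E3 → E3} (hφ : IsSolenoidalTest Ω φ)
    (hχ : IsSolenoidalTest Ω χ) : ∫ x, tri (φ x) (grad χ x) (χ x) = 0 := by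
  have hint : ∀ i j : Fin 3, Integrable fun x => φ x i * grad χ x (i, j) * χ x j := fun i j =>
    hχ.integrable_mul_apply ((hφ.contDiff_apply i).continuous.mul
      (hχ.continuous_grad_apply i j)) j
  have hint' : ∀ i j : Fin 3, Integrable fun x => grad φ x (i, i) * χ x j * χ x j := fun i j =>
    hχ.integrable_mul_apply ((hφ.continuous_grad_apply i i).mul
      (hχ.contDiff_apply j).continuous) j
  have hsum : ∫ x, tri (φ x) (grad χ x) (χ x)
      = ∑ i, ∑ j, ∫ x, φ x i * grad χ x (i, j) * χ x j := by
    unfold tri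
    rw [integral_finsetSum _ fun i _ => integrable_finsetSum _ fun j _ => hint i j]
    exact Finset.sum_congr rfl fun i _ => integral_finsetSum _ fun j _ => hint i j
  have h2 : 2 * ∫ x, tri (φ x) (grad χ x) (χ x) = 0 := by
    simp only [hsum, Finset.mul_sum, two_mul_integral_convection hφ hχ]
    rw [Finset.sum_comm]
    refine Finset.sum_eq_zero fun j _ => ?_
    rw [Finset.sum_neg_distrib, ← integral_finsetSum _ fun i _ => hint' i j]
    simp_rw [← Finset.sum_mul, hφ.div_free]
    simp
  linarith

/-- For test fields, integration by parts leaves only div φ = 0. The continuity of the trilinear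
form on V and the density of test fields do the rest. -/
theorem IsSobolevConst.b_self_eq_zero (hK : IsSobolevConst Ω K) (U W : V Ω) : b U W W = 0 := by
  have hcont : Continuous fun p : V Ω × V Ω => bForm hK p.1 p.2 p.2 :=
    (((bForm hK).continuous.comp continuous_fst).clm_apply continuous_snd).clm_apply continuous_snd
  have hd : Dense ({U : V Ω | IsTestField U} ×ˢ {U : V Ω | IsTestField U}) :=
    dense_isTestField.prod dense_isTestField
  have h0 : (fun p : V Ω × V Ω => bForm hK p.1 p.2 p.2) = fun _ => 0 := by
    refine hcont.ext_on hd continuous_const ?_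
    rintro ⟨U, W⟩ ⟨⟨φ, hφ, h1, -⟩, ⟨χ, hχ, h3, h4⟩⟩
    simp only [bForm_apply, b_eq_integral_tri]
    rw [← integral_tri_self_eq_zero hφ hχ,
      ← setIntegral_eq_integral_of_forall_compl_eq_zero (s := Ω)
        (f := fun x => tri (φ x) (grad χ x) (χ x))]
    · refine integral_congr_ae ?_
      filter_upwards [h1, h3, h4] with x e1 e3 e4
      rw [e1, e3, e4]
    · intro x hx
      rw [image_eq_zero_of_notMem_tsupport fun h => hx (hφ.support_subset h)]
      simp [tri]
  exact congrFun h0 (U, W)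

end Convection

/-! ### The damping term. -/

section Damping

theorem damping_eq (β : ℝ) (U Z : V Ω) :
    damping β U Z = ∫ x in Ω, ⟪damp (β - 1) (fieldV U x), fieldV Z x⟫ := by
  simp only [damping, damp, real_inner_smul_left]

theorem IsSobolevConst.lintegral_damping_le (hK : IsSobolevConst Ω K) {s : ℝ} (hs0 : 0 ≤ s)
    (hs2 : s ≤ 2) {p : E3 → ℝ} (hp : AEStronglyMeasurable p (volume.restrict Ω)) {P : ℝ}
    (hP : 0 ≤ P) (hpP : eLpNorm p 6 (volume.restrict Ω) ≤ ENNReal.ofReal (K * P)) (Q Z : V Ω) :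
    ∫⁻ x in Ω, ‖p x‖ₑ ^ s * ‖fieldV Q x‖ₑ * ‖fieldV Z x‖ₑ
      ≤ ENNReal.ofReal (K ^ 4 * (P ^ s * normV Q * ‖fieldV Z‖)) := by
  have hK0 : 0 ≤ K := by linarith [hK.one_le]
  have hQ := normV_nonneg Q
  calc _ ≤ _ := lintegral_rpow_mul_mul_le hs0 hs2 hp (Lp.aestronglyMeasurable (fieldV Q))
        (Lp.aestronglyMeasurable (fieldV Z))
    _ ≤ ENNReal.ofReal ((K * P) ^ s) * ENNReal.ofReal (K * normV Q) *
        ENNReal.ofReal ‖fieldV Z‖ * ENNReal.ofReal (K ^ ((2 - s) / 6)) := by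
        rw [← ENNReal.ofReal_rpow_of_nonneg (by positivity) hs0,
          ← ENNReal.ofReal_rpow_of_nonneg hK0 (by linarith), Measure.restrict_apply_univ,
          show eLpNorm (fieldV Z) 2 (volume.restrict Ω) = ENNReal.ofReal ‖fieldV Z‖ by
            rw [Lp.norm_def, ENNReal.ofReal_toReal (Lp.eLpNorm_ne_top _)]]
        gcongr
        · exact hK.eLpNorm_six_le Q
        · exact hK.volume_le
    _ ≤ _ := by
        rw [← ENNReal.ofReal_mul (by positivity), ← ENNReal.ofReal_mul (by positivity),
          ← ENNReal.ofReal_mul (by positivity)]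
        refine ENNReal.ofReal_le_ofReal ?_
        rw [Real.mul_rpow hK0 hP]
        have h1 : K ^ s ≤ K ^ 2 := by
          rw [← Real.rpow_two]; exact Real.rpow_le_rpow_of_exponent_le hK.one_le hs2
        have h2 : K ^ ((2 - s) / 6) ≤ K := by
          conv_rhs => rw [← Real.rpow_one K]
          exact Real.rpow_le_rpow_of_exponent_le hK.one_le (by linarith)
        have h3 : K ^ s * K ^ ((2 - s) / 6) ≤ K ^ 2 * K :=
          mul_le_mul h1 h2 (by positivity) (by positivity)
        calc K ^ s * P ^ s * (K * normV Q) * ‖fieldV Z‖ * K ^ ((2 - s) / 6)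
            = (K ^ s * K ^ ((2 - s) / 6)) * (K * (P ^ s * normV Q * ‖fieldV Z‖)) := by ring
          _ ≤ (K ^ 2 * K) * (K * (P ^ s * normV Q * ‖fieldV Z‖)) :=
              mul_le_mul_of_nonneg_right h3 (by positivity)
          _ = _ := by ring

theorem aestronglyMeasurable_inner_damp {s : ℝ} (hs : 0 ≤ s) (U Z : V Ω) :
    AEStronglyMeasurable (fun x => ⟪damp s (fieldV U x), fieldV Z x⟫) (volume.restrict Ω) :=
  ((continuous_damp hs).comp_aestronglyMeasurable (Lp.aestronglyMeasurable _)).inner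
    (Lp.aestronglyMeasurable _)

theorem IsSobolevConst.damping_bound (hK : IsSobolevConst Ω K) {β : ℝ} (hβ₁ : 1 ≤ β)
    (hβ₃ : β ≤ 3) (U Z : V Ω) :
    Integrable (fun x => ⟪damp (β - 1) (fieldV U x), fieldV Z x⟫) (volume.restrict Ω) ∧
    |damping β U Z| ≤ K ^ 4 * (normV U ^ (β - 1) * normV U * ‖fieldV Z‖) := by
  have hK0 : 0 ≤ K := by linarith [hK.one_le]
  have hU := normV_nonneg U
  rw [damping_eq]
  refine integrable_and_abs_integral_le (aestronglyMeasurable_inner_damp (by linarith) U Z)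
    (by positivity) ?_
  refine le_trans (lintegral_mono fun x => ?_) (hK.lintegral_damping_le (s := β - 1)
    (by linarith) (by linarith) (p := fun x => ‖fieldV U x‖)
    (Lp.aestronglyMeasurable (fieldV U)).norm hU ?_ U Z)
  · rw [← ofReal_norm, enorm_norm, ← ofReal_norm, ← ofReal_norm,
      ENNReal.ofReal_rpow_of_nonneg (norm_nonneg _) (by linarith),
      ← ENNReal.ofReal_mul (by positivity), ← ENNReal.ofReal_mul (by positivity), ← norm_damp]
    exact ENNReal.ofReal_le_ofReal (norm_inner_le_norm _ _)
  · rw [eLpNorm_norm]; exact hK.eLpNorm_six_le U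

/-- The local Lipschitz bound on |a|^(β-1)a, integrated by Hölder. It serves the continuity of the
damping as a map V → V', hence its measurability along a solution. -/
theorem IsSobolevConst.abs_damping_sub_le (hK : IsSobolevConst Ω K) {β : ℝ} (hβ₁ : 1 ≤ β)
    (hβ₃ : β ≤ 3) (U W Z : V Ω) :
    |damping β U Z - damping β W Z| ≤
      3 * (K ^ 4 * ((normV U + normV W) ^ (β - 1) * normV (U - W) * ‖fieldV Z‖)) := by
  have hK0 : 0 ≤ K := by linarith [hK.one_le]
  have hU := normV_nonneg U
  have hW := normV_nonneg W
  have hUW := normV_nonneg (U - W)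
  rw [damping_eq, damping_eq, ← integral_sub (hK.damping_bound hβ₁ hβ₃ U Z).1
    (hK.damping_bound hβ₁ hβ₃ W Z).1]
  refine (integrable_and_abs_integral_le ((aestronglyMeasurable_inner_damp (by linarith) U Z).sub
    (aestronglyMeasurable_inner_damp (by linarith) W Z)) (by positivity) ?_).2
  have hm := hK.lintegral_damping_le (s := β - 1) (by linarith) (by linarith)
    (p := fun x => ‖fieldV U x‖ + ‖fieldV W x‖) (P := normV U + normV W)
    ((Lp.aestronglyMeasurable (fieldV U)).norm.add (Lp.aestronglyMeasurable (fieldV W)).norm)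
    (by positivity) ?_ (U - W) Z
  · rw [ENNReal.ofReal_mul (by norm_num)]
    refine le_trans ?_ (mul_le_mul' le_rfl hm)
    rw [← lintegral_const_mul' _ _ ENNReal.ofReal_ne_top]
    refine lintegral_mono_ae ?_
    filter_upwards [fieldV_sub U W] with x hx
    rw [hx, Pi.sub_apply, ← inner_sub_left, ← ofReal_norm, ← ofReal_norm, ← ofReal_norm,
      ← ofReal_norm,
      ENNReal.ofReal_rpow_of_nonneg (norm_nonneg _) (by linarith),
      ← ENNReal.ofReal_mul (by positivity), ← ENNReal.ofReal_mul (by positivity),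
      ← ENNReal.ofReal_mul (by positivity)]
    refine ENNReal.ofReal_le_ofReal ((norm_inner_le_norm _ _).trans ?_)
    rw [Real.norm_of_nonneg (by positivity : 0 ≤ ‖fieldV U x‖ + ‖fieldV W x‖), ← mul_assoc]
    exact mul_le_mul_of_nonneg_right
      (norm_damp_sub_le (by linarith) (by linarith) _ _) (norm_nonneg _)
  · refine (eLpNorm_add_le (Lp.aestronglyMeasurable (fieldV U)).norm
      (Lp.aestronglyMeasurable (fieldV W)).norm (by norm_num)).trans ?_
    rw [eLpNorm_norm, eLpNorm_norm, mul_add, ENNReal.ofReal_add (by positivity) (by positivity)]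
    exact add_le_add (hK.eLpNorm_six_le U) (hK.eLpNorm_six_le W)

/-- The damping term as an element of `V'`. -/
noncomputable def dampDual (hK : IsSobolevConst Ω K) {β : ℝ} (hβ₁ : 1 ≤ β) (hβ₃ : β ≤ 3)
    (U : V Ω) : VDual Ω :=
  LinearMap.mkContinuous
    { toFun := fun Z => damping β U Z
      map_add' := fun Z Z' => by
        simp only [damping_eq]
        rw [← integral_add (hK.damping_bound hβ₁ hβ₃ U Z).1 (hK.damping_bound hβ₁ hβ₃ U Z').1]
        refine integral_congr_ae ?_
        filter_upwards [fieldV_add Z Z'] with x hx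
        rw [hx, inner_add_right]
      map_smul' := fun c Z => by
        simp only [damping_eq, RingHom.id_apply, smul_eq_mul]
        rw [← integral_const_mul]
        refine integral_congr_ae ?_
        filter_upwards [fieldV_smul c Z] with x hx
        rw [hx, real_inner_smul_right] }
    (K ^ 4 * (normV U ^ (β - 1) * normV U))
    (fun Z => by
      have hK0 : 0 ≤ K := by linarith [hK.one_le]
      have hU := normV_nonneg U
      refine (hK.damping_bound hβ₁ hβ₃ U Z).2.trans ?_
      rw [← mul_assoc (K ^ 4)]
      exact mul_le_mul_of_nonneg_left (norm_fieldV_le_norm Z) (by positivity))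

theorem dampDual_apply (hK : IsSobolevConst Ω K) {β : ℝ} (hβ₁ : 1 ≤ β) (hβ₃ : β ≤ 3)
    (U Z : V Ω) : dampDual hK hβ₁ hβ₃ U Z = damping β U Z := rfl

theorem continuous_dampDual (hK : IsSobolevConst Ω K) {β : ℝ} (hβ₁ : 1 ≤ β) (hβ₃ : β ≤ 3) :
    Continuous (dampDual hK hβ₁ hβ₃ : V Ω → VDual Ω) := by
  have hK0 : 0 ≤ K := by linarith [hK.one_le]
  refine continuous_iff_continuousAt.2 fun W => ?_
  refine (tendsto_iff_norm_sub_tendsto_zero (E := VDual Ω)).2 ?_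
  have hbound : ∀ U : V Ω, ‖dampDual hK hβ₁ hβ₃ U - dampDual hK hβ₁ hβ₃ W‖ ≤
      3 * (K ^ 4 * ((normV U + normV W) ^ (β - 1) * normV (U - W))) := by
    intro U
    have hU := normV_nonneg U
    have hW := normV_nonneg W
    have hUW := normV_nonneg (U - W)
    refine ContinuousLinearMap.opNorm_le_bound _ (by positivity) fun Z => ?_
    rw [sub_apply, dampDual_apply, dampDual_apply]
    refine (hK.abs_damping_sub_le hβ₁ hβ₃ U W Z).trans ?_
    calc 3 * (K ^ 4 * ((normV U + normV W) ^ (β - 1) * normV (U - W) * ‖fieldV Z‖))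
        = 3 * (K ^ 4 * ((normV U + normV W) ^ (β - 1) * normV (U - W))) * ‖fieldV Z‖ := by ring
      _ ≤ _ := mul_le_mul_of_nonneg_left (norm_fieldV_le_norm Z) (by positivity)
  refine squeeze_zero (fun _ => ContinuousLinearMap.opNorm_nonneg _) hbound ?_
  have hc : Continuous fun U : V Ω =>
      3 * (K ^ 4 * ((normV U + normV W) ^ (β - 1) * normV (U - W))) := by
    have h1 := continuous_normV (Ω := Ω)
    have h2 : Continuous fun U : V Ω => (normV U + normV W) ^ (β - 1) :=
      (h1.add continuous_const).rpow_const fun _ => Or.inr (by linarith)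
    have h3 : Continuous fun U : V Ω => normV (U - W) := h1.comp (continuous_id.sub continuous_const)
    exact continuous_const.mul (continuous_const.mul (h2.mul h3))
  have hz : normV (0 : V Ω) = 0 := norm_zero (E := L2Mat Ω)
  simpa [hz] using hc.tendsto W

theorem IsSobolevConst.damping_monotone (hK : IsSobolevConst Ω K) {β : ℝ} (hβ₁ : 1 ≤ β)
    (hβ₃ : β ≤ 3) (U W : V Ω) : 0 ≤ damping β U (U - W) - damping β W (U - W) := by
  rw [damping_eq, damping_eq, ← integral_sub (hK.damping_bound hβ₁ hβ₃ U _).1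
    (hK.damping_bound hβ₁ hβ₃ W _).1]
  refine integral_nonneg_of_ae ?_
  filter_upwards [fieldV_sub U W] with x hx
  rw [hx, ← inner_sub_left]
  exact inner_damp_sub_nonneg (by linarith) _ _

end Damping

/-! ### Lipschitz estimates for the cutoff. -/

section Cutoff

/-- This form has no case distinction and reduces the Lipschitz estimates to those of max. -/
theorem F_eq_div {N r : ℝ} (hN : 0 < N) (hr : 0 ≤ r) : F N r = N / max N r := by
  unfold F
  split_ifs with h
  · rw [h, max_eq_left hN.le, div_self hN.ne']
  · have hr' : 0 < r := lt_of_le_of_ne hr (Ne.symm h)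
    rcases le_total N r with h1 | h1
    · rw [max_eq_right h1, min_eq_right ((div_le_one hr').2 h1)]
    · rw [max_eq_left h1, div_self hN.ne', min_eq_left ((one_le_div hr').2 h1)]

theorem F_nonneg {N r : ℝ} (hN : 0 < N) (hr : 0 ≤ r) : 0 ≤ F N r := by
  rw [F_eq_div hN hr]
  exact div_nonneg hN.le (hN.le.trans (le_max_left _ _))

theorem F_mul_le {N r : ℝ} (hN : 0 < N) (hr : 0 ≤ r) : F N r * r ≤ N := by
  rw [F_eq_div hN hr, div_mul_eq_mul_div, div_le_iff₀ (hN.trans_le (le_max_left _ _))]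
  exact mul_le_mul_of_nonneg_left (le_max_right _ _) hN.le

/-- With x = max(M, p) and y = max(N, r), the difference of the cutoffs is ((M - N) + (N/y)(y -
x))/x. The weight p cancels the 1/x, and max is Lipschitz. The factor N/y is kept because it can
absorb a further r. -/
theorem abs_F_sub_F_le {M N p r : ℝ} (hM : 0 < M) (hN : 0 < N) (hp : 0 ≤ p) (hr : 0 ≤ r) :
    |F M p - F N r| * p ≤ |M - N| + (N / max N r) * (|M - N| + |r - p|) := by
  rw [F_eq_div hM hp, F_eq_div hN hr]
  set x := max M p
  set y := max N r
  have hx : 0 < x := hM.trans_le (le_max_left _ _)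
  have hy : 0 < y := hN.trans_le (le_max_left _ _)
  have hpx : p ≤ x := le_max_right _ _
  have hxy : |y - x| ≤ |M - N| + |r - p| := by
    refine (abs_max_sub_max_le_max N r M p).trans (max_le ?_ ?_)
    · rw [abs_sub_comm]; linarith [abs_nonneg (r - p)]
    · linarith [abs_nonneg (M - N)]
  have h1 : M / x - N / y = ((M - N) + (N / y) * (y - x)) / x := by
    field_simp; ring
  have hNy : 0 ≤ N / y := (div_pos hN hy).le
  have h2 : |(M - N) + (N / y) * (y - x)| ≤ |M - N| + (N / y) * (|M - N| + |r - p|) := by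
    refine (abs_add_le _ _).trans (add_le_add le_rfl ?_)
    rw [abs_mul, abs_of_nonneg hNy]
    exact mul_le_mul_of_nonneg_left hxy hNy
  rw [h1, abs_div, abs_of_pos hx, div_mul_eq_mul_div, div_le_iff₀ hx]
  exact mul_le_mul h2 hpx hp ((abs_nonneg _).trans h2)

theorem abs_F_sub_F_mul_mul_le {M N p r : ℝ} (hM : 0 < M) (hN : 0 < N) (hp : 0 ≤ p)
    (hr : 0 ≤ r) : |F M p - F N r| * p * r ≤ 2 * |M - N| * r + N * |r - p| := by
  have h := mul_le_mul_of_nonneg_right (abs_F_sub_F_le hM hN hp hr) hr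
  refine h.trans ?_
  set y := max N r
  have hy : 0 < y := hN.trans_le (le_max_left _ _)
  have h1 : N / y ≤ 1 := (div_le_one hy).2 (le_max_left _ _)
  have h2 : N / y * r ≤ N := by
    rw [div_mul_eq_mul_div, div_le_iff₀ hy]
    exact mul_le_mul_of_nonneg_left (le_max_right _ _) hN.le
  have h3 := mul_le_mul_of_nonneg_right h1 (mul_nonneg (abs_nonneg (M - N)) hr)
  have h4 := mul_le_mul_of_nonneg_right h2 (abs_nonneg (r - p))
  nlinarith

/-- The cutoffs evaluated at powers, weighted by the smaller base. -/
theorem abs_F_rpow_sub_F_rpow_le {M N p r s : ℝ} (hM : 0 < M) (hN : 0 < N) (hp : 0 ≤ p)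
    (hpr : p ≤ r) (hs0 : 0 ≤ s) (hs2 : s ≤ 2) :
    |F M (p ^ s) - F N (r ^ s)| * (p ^ s * p) ≤ 2 * |M - N| * p + 2 * N * |r - p| := by
  have hr : 0 ≤ r := hp.trans hpr
  have hP := Real.rpow_nonneg hp s
  have hR := Real.rpow_nonneg hr s
  have hPR : p ^ s ≤ r ^ s := Real.rpow_le_rpow hp hpr hs0
  have h := mul_le_mul_of_nonneg_right (abs_F_sub_F_le hM hN hP hR) hp
  rw [mul_assoc] at h
  refine h.trans ?_
  set y := max N (r ^ s)
  have hy : 0 < y := hN.trans_le (le_max_left _ _)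
  have h1 : N / y ≤ 1 := (div_le_one hy).2 (le_max_left _ _)
  have h2 : N / y * r ^ s ≤ N := by
    rw [div_mul_eq_mul_div, div_le_iff₀ hy]
    exact mul_le_mul_of_nonneg_left (le_max_right _ _) hN.le
  rw [abs_of_nonneg (sub_nonneg.2 hPR), abs_of_nonneg (sub_nonneg.2 hpr)]
  have h3 := mul_le_mul_of_nonneg_right h1 (mul_nonneg (abs_nonneg (M - N)) hp)
  -- The loss r^s is exactly what N / max(N, r^s) absorbs. Having the smaller base p as weight is
  -- what makes this bound available.
  have h4 : (r ^ s - p ^ s) * p ≤ 2 * r ^ s * (r - p) := by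
    refine le_trans ?_ (mul_rpow_sub_rpow_le hs0 hs2 hp hpr)
    rw [mul_comm]
    exact mul_le_mul_of_nonneg_right hpr (sub_nonneg.2 hPR)
  have h5 := mul_le_mul_of_nonneg_left h4 (div_pos hN hy).le
  have h6 := mul_le_mul_of_nonneg_right h2 (sub_nonneg.2 hpr)
  nlinarith

theorem measurable_F (N : ℝ) : Measurable (F N) := by
  unfold F
  exact Measurable.ite (measurableSet_singleton 0) measurable_const
    (measurable_const.min (measurable_const.div measurable_id))

end Cutoff

/-! ### Differences of the nonlinear terms, and absorption by the viscosity. -/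

theorem normV_sub_comm (U W : V Ω) : normV (U - W) = normV (W - U) :=
  norm_sub_rev (gradV U) (gradV W)

theorem abs_normV_sub_normV_le (U W : V Ω) : |normV U - normV W| ≤ normV (U - W) :=
  abs_norm_sub_norm_le (gradV U) (gradV W)

/-- The difference of the convection terms, tested with the difference of the fields. -/
theorem IsSobolevConst.convection_sub_le (hK : IsSobolevConst Ω K) {M N : ℝ} (hM : 0 < M)
    (hN : 0 < N) (U W : V Ω) :
    |F M (normV W) * b W W (W - U) - F N (normV U) * b U U (W - U)| ≤
      K ^ 2 * (√‖fieldV (W - U)‖ * √(normV (W - U))) *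
        ((M + N) * normV (W - U) + 2 * |M - N| * normV U) := by
  set Z := W - U with hZ
  have hW : W = U + Z := by rw [hZ]; abel
  have e1 : b W W Z = b Z W Z + b U W Z := by
    rw [add_comm, ← hK.b_add_left, ← hW]
  -- W is kept in the middle slot, so that the difference of cutoffs is multiplied by both norms ‖U‖
  -- and ‖W‖, as the two-weight cutoff estimate requires.
  have e2 : b U W Z = b U U Z := by
    conv_lhs => rw [hW]
    rw [hK.b_add_middle, hK.b_self_eq_zero U Z, add_zero]
  have e3 : F M (normV W) * b W W Z - F N (normV U) * b U U Z
      = F M (normV W) * b Z W Z + (F M (normV W) - F N (normV U)) * b U W Z := by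
    rw [e1, ← e2]; ring
  have hnW := normV_nonneg W
  have hnU := normV_nonneg U
  have hnZ := normV_nonneg Z
  have hF := F_nonneg hM hnW
  set q := √‖fieldV Z‖ * √(normV Z) with hq
  have hq0 : 0 ≤ q := by positivity
  have b1 := (hK.tri_bound Z W Z).2
  have b2 := (hK.tri_bound U W Z).2
  rw [← hq] at b1 b2
  have hKq : 0 ≤ K ^ 2 * q := by positivity
  have t1 : |F M (normV W) * b Z W Z| ≤ K ^ 2 * q * (M * normV Z) := by
    rw [abs_mul, abs_of_nonneg hF]
    calc F M (normV W) * |b Z W Z| ≤ F M (normV W) * (K ^ 2 * normV Z * normV W * q) :=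
          mul_le_mul_of_nonneg_left b1 hF
      _ = (F M (normV W) * normV W) * (K ^ 2 * q * normV Z) := by ring
      _ ≤ M * (K ^ 2 * q * normV Z) :=
          mul_le_mul_of_nonneg_right (F_mul_le hM hnW) (by positivity)
      _ = _ := by ring
  have t2 : |(F M (normV W) - F N (normV U)) * b U W Z| ≤
      K ^ 2 * q * (2 * |M - N| * normV U + N * normV Z) := by
    rw [abs_mul]
    calc |F M (normV W) - F N (normV U)| * |b U W Z|
        ≤ |F M (normV W) - F N (normV U)| * (K ^ 2 * normV U * normV W * q) :=
          mul_le_mul_of_nonneg_left b2 (abs_nonneg _)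
      _ = (K ^ 2 * q) * (|F M (normV W) - F N (normV U)| * normV W * normV U) := by ring
      _ ≤ (K ^ 2 * q) * (2 * |M - N| * normV U + N * normV Z) := by
          refine mul_le_mul_of_nonneg_left ((abs_F_sub_F_mul_mul_le hM hN hnW hnU).trans ?_) hKq
          have := abs_normV_sub_normV_le U W
          rw [normV_sub_comm, ← hZ] at this
          exact add_le_add le_rfl (mul_le_mul_of_nonneg_left this hN.le)
  rw [e3]
  refine (abs_add_le _ _).trans ((add_le_add t1 t2).trans (le_of_eq ?_))
  ring

/-- The difference of the damping terms, tested with the difference of the fields. -/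
theorem IsSobolevConst.damping_sub_ge (hK : IsSobolevConst Ω K) {β : ℝ} (hβ₁ : 1 ≤ β)
    (hβ₃ : β ≤ 3) {M N : ℝ} (hM : 0 < M) (hN : 0 < N) (U W : V Ω) :
    -(K ^ 4 * ‖fieldV (W - U)‖ * (2 * |M - N| * normV U + 2 * (M + N) * normV (W - U))) ≤
      F M (normV W ^ (β - 1)) * damping β W (W - U)
        - F N (normV U ^ (β - 1)) * damping β U (W - U) := by
  have hK0 : 0 ≤ K := by linarith [hK.one_le]
  have hnW := normV_nonneg W
  have hnU := normV_nonneg U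
  have hnZ := normV_nonneg (W - U)
  have hmon := hK.damping_monotone hβ₁ hβ₃ W U
  have hd := abs_normV_sub_normV_le W U
  have hy := norm_nonneg (fieldV (W - U))
  have hPW := Real.rpow_nonneg hnW (β - 1)
  have hPU := Real.rpow_nonneg hnU (β - 1)
  have hMN := abs_nonneg (M - N)
  -- The difference of cutoffs multiplies the damping of the field with the smaller norm; the other
  -- field's cutoff multiplies the monotone difference, which has the right sign.
  rcases le_total (normV W) (normV U) with h | h
  · have h1 := abs_F_rpow_sub_F_rpow_le hM hN hnW h (by linarith : 0 ≤ β - 1) (by linarith)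
    have h2 := (hK.damping_bound hβ₁ hβ₃ W (W - U)).2
    have h3 := mul_nonneg (F_nonneg hN hPU) hmon
    have h4 : |(F M (normV W ^ (β - 1)) - F N (normV U ^ (β - 1))) * damping β W (W - U)| ≤
        K ^ 4 * ‖fieldV (W - U)‖ * (2 * |M - N| * normV U + 2 * (M + N) * normV (W - U)) := by
      rw [abs_mul]
      refine (mul_le_mul_of_nonneg_left h2 (abs_nonneg _)).trans ?_
      calc _ = K ^ 4 * ‖fieldV (W - U)‖ * (|F M (normV W ^ (β - 1)) - F N (normV U ^ (β - 1))| *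
            (normV W ^ (β - 1) * normV W)) := by ring
        _ ≤ _ := by
          refine mul_le_mul_of_nonneg_left (h1.trans ?_) (by positivity)
          rw [abs_sub_comm] at hd
          have := mul_le_mul_of_nonneg_left hd hN.le
          have := mul_le_mul_of_nonneg_left h hMN
          have := mul_nonneg hM.le hnZ
          nlinarith
    have h5 := neg_abs_le
      ((F M (normV W ^ (β - 1)) - F N (normV U ^ (β - 1))) * damping β W (W - U))
    nlinarith
  · have h1 := abs_F_rpow_sub_F_rpow_le hN hM hnU h (by linarith : 0 ≤ β - 1) (by linarith)
    have h2 := (hK.damping_bound hβ₁ hβ₃ U (W - U)).2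
    have h3 := mul_nonneg (F_nonneg hM hPW) hmon
    have h4 : |(F M (normV W ^ (β - 1)) - F N (normV U ^ (β - 1))) * damping β U (W - U)| ≤
        K ^ 4 * ‖fieldV (W - U)‖ * (2 * |M - N| * normV U + 2 * (M + N) * normV (W - U)) := by
      rw [abs_mul]
      refine (mul_le_mul_of_nonneg_left h2 (abs_nonneg _)).trans ?_
      calc _ = K ^ 4 * ‖fieldV (W - U)‖ * (|F N (normV U ^ (β - 1)) - F M (normV W ^ (β - 1))| *
            (normV U ^ (β - 1) * normV U)) := by rw [abs_sub_comm]; ring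
        _ ≤ _ := by
          refine mul_le_mul_of_nonneg_left (h1.trans ?_) (by positivity)
          rw [abs_sub_comm N M]
          have := mul_le_mul_of_nonneg_left hd hM.le
          have := mul_nonneg hN.le hnZ
          nlinarith
    have h5 := neg_abs_le
      ((F M (normV W ^ (β - 1)) - F N (normV U ^ (β - 1))) * damping β U (W - U))
    nlinarith

/-- The absorption of the nonlinear terms by the viscosity; `q` stands for `√(x y)`. -/
theorem young_absorption {μ α k L x y q d r g : ℝ} (hμ : 0 < μ) (hq : q ^ 2 = x * y) :
    -(μ * x ^ 2) + k ^ 2 * q * (L * x + 2 * d * r)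
      + α * (k ^ 4 * y * (2 * d * r + 2 * L * x)) + g * y ≤
      (k ^ 8 * L ^ 4 / μ ^ 3 + k ^ 8 / μ + 4 * α ^ 2 * k ^ 8 * L ^ 2 / μ + α ^ 2 * k ^ 8 + 1 / 2)
        * y ^ 2 + 2 * (d * r) ^ 2 + g ^ 2 / 2 := by
  have young : ∀ A B : ℝ, A * B ≤ μ / 4 * A ^ 2 + B ^ 2 / μ := by
    intro A B
    have h : μ / 4 * A ^ 2 + B ^ 2 / μ - A * B = (μ * A - 2 * B) ^ 2 / (4 * μ) := by
      field_simp; ring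
    have h2 : 0 ≤ (μ * A - 2 * B) ^ 2 / (4 * μ) := by positivity
    linarith
  -- Four applications, each costing μ/4 of x², use up the viscosity exactly. The second is applied
  -- to the remainder of the first, since q² = xy still contains x; this produces L⁴/μ³. The two
  -- squares (dr)² in the conclusion come from the terms carrying d in the convection and in the
  -- damping.
  have h1 := young x (k ^ 2 * L * q)
  have h2 := young x (k ^ 4 * L ^ 2 * y / μ)
  have h3 := young x (k ^ 4 * y)
  have h4 := young x (2 * α * k ^ 4 * L * y)
  have e1 : (k ^ 2 * L * q) ^ 2 / μ = x * (k ^ 4 * L ^ 2 * y / μ) := by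
    rw [mul_pow, hq]; ring
  have e2 : (k ^ 4 * L ^ 2 * y / μ) ^ 2 / μ = k ^ 8 * L ^ 4 / μ ^ 3 * y ^ 2 := by
    field_simp
  have e3 : (k ^ 4 * y) ^ 2 / μ = k ^ 8 / μ * y ^ 2 := by ring
  have e4 : (2 * α * k ^ 4 * L * y) ^ 2 / μ = 4 * α ^ 2 * k ^ 8 * L ^ 2 / μ * y ^ 2 := by ring
  have h5 : 2 * (k ^ 2 * q) * (d * r) ≤ x * (k ^ 4 * y) + (d * r) ^ 2 := by
    have : (k ^ 2 * q) ^ 2 = x * (k ^ 4 * y) := by rw [mul_pow, hq]; ring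
    nlinarith [sq_nonneg (k ^ 2 * q - d * r)]
  have h6 : 2 * (α * k ^ 4 * y) * (d * r) ≤ α ^ 2 * k ^ 8 * y ^ 2 + (d * r) ^ 2 := by
    nlinarith [sq_nonneg (α * k ^ 4 * y - d * r)]
  have h7 : g * y ≤ g ^ 2 / 2 + y ^ 2 / 2 := by nlinarith [sq_nonneg (g - y)]
  rw [e1] at h1
  rw [e2] at h2
  rw [e3] at h3
  rw [e4] at h4
  linarith

/-- The growth rate in the continuous dependence estimate. -/
noncomputable def rate (K μ α M N : ℝ) : ℝ :=
  2 * (K ^ 8 * (M + N) ^ 4 / μ ^ 3 + K ^ 8 / μ + 4 * α ^ 2 * K ^ 8 * (M + N) ^ 2 / μ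
    + α ^ 2 * K ^ 8 + 1 / 2)

theorem rate_pos {K μ α M N : ℝ} (hμ : 0 < μ) : 0 < rate K μ α M N := by
  unfold rate; positivity

theorem rate_mono {K μ α M M' N : ℝ} (hμ : 0 < μ) (hM : 0 ≤ M) (hN : 0 ≤ N) (h : M ≤ M') :
    rate K μ α M N ≤ rate K μ α M' N := by
  unfold rate
  gcongr

/-! ### The operator V → V' of the equation. -/

section Operator

/-- The Stokes operator `u ↦ ((u, ·))`. -/
noncomputable def stokes (U : V Ω) : VDual Ω := (innerSL ℝ (gradL U)).comp gradL

theorem continuous_stokes : Continuous (stokes : V Ω → VDual Ω) :=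
  ((innerSL ℝ).continuous.comp gradL.continuous).clm_comp continuous_const

/-- The left-hand side of the equation without the time derivative, as an element of `V'`. -/
noncomputable def opDual (hK : IsSobolevConst Ω K) {β : ℝ} (hβ₁ : 1 ≤ β) (hβ₃ : β ≤ 3)
    (μ α N : ℝ) (U : V Ω) : VDual Ω :=
  μ • stokes U + F N (normV U) • bForm hK U U
    + (α * F N (normV U ^ (β - 1))) • dampDual hK hβ₁ hβ₃ U

theorem opDual_apply (hK : IsSobolevConst Ω K) {β : ℝ} (hβ₁ : 1 ≤ β) (hβ₃ : β ≤ 3)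
    (μ α N : ℝ) (U Z : V Ω) : opDual hK hβ₁ hβ₃ μ α N U Z =
      μ * innerV U Z + F N (normV U) * b U U Z
        + α * (F N (normV U ^ (β - 1)) * damping β U Z) := by
  rw [← mul_assoc α]; rfl

/-- Linear growth, from F_N(r) r ≤ N at r = ‖U‖ and at r = ‖U‖^(β-1). It puts A(u) in L²(τ,T;V') as
soon as u is in L²(τ,T;V). -/
theorem norm_opDual_le (hK : IsSobolevConst Ω K) {β : ℝ} (hβ₁ : 1 ≤ β) (hβ₃ : β ≤ 3)
    {μ α N : ℝ} (hμ : 0 < μ) (hα : 0 < α) (hN : 0 < N) (U : V Ω) :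
    ‖opDual hK hβ₁ hβ₃ μ α N U‖ ≤ (μ + K ^ 3 * N + α * K ^ 4 * N) * ‖U‖ := by
  have hK0 : 0 ≤ K := by linarith [hK.one_le]
  have hU := normV_nonneg U
  have hP := Real.rpow_nonneg hU (β - 1)
  refine ContinuousLinearMap.opNorm_le_bound _ (by positivity) fun Z => ?_
  have hZ := normV_nonneg Z
  rw [opDual_apply, Real.norm_eq_abs]
  have t1 : |μ * innerV U Z| ≤ μ * (normV U * ‖Z‖) := by
    rw [abs_mul, abs_of_pos hμ]
    refine mul_le_mul_of_nonneg_left ((abs_real_inner_le_norm (gradV U) (gradV Z)).trans ?_) hμ.le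
    exact mul_le_mul_of_nonneg_left (normV_le_norm Z) hU
  have t2 : |F N (normV U) * b U U Z| ≤ K ^ 3 * N * (normV U * ‖Z‖) := by
    rw [abs_mul, abs_of_nonneg (F_nonneg hN hU)]
    calc _ ≤ F N (normV U) * (K ^ 3 * normV U * normV U * normV Z) :=
          mul_le_mul_of_nonneg_left (hK.abs_b_le U U Z) (F_nonneg hN hU)
      _ = (F N (normV U) * normV U) * (K ^ 3 * (normV U * normV Z)) := by ring
      _ ≤ N * (K ^ 3 * (normV U * ‖Z‖)) := by
          refine mul_le_mul (F_mul_le hN hU) ?_ (by positivity) hN.le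
          gcongr
          exact normV_le_norm Z
      _ = _ := by ring
  have t3 : |α * (F N (normV U ^ (β - 1)) * damping β U Z)| ≤
      α * K ^ 4 * N * (normV U * ‖Z‖) := by
    rw [abs_mul, abs_mul, abs_of_pos hα, abs_of_nonneg (F_nonneg hN hP)]
    calc _ ≤ α * (F N (normV U ^ (β - 1)) * (K ^ 4 * (normV U ^ (β - 1) * normV U *
          ‖fieldV Z‖))) := mul_le_mul_of_nonneg_left (mul_le_mul_of_nonneg_left
            (hK.damping_bound hβ₁ hβ₃ U Z).2 (F_nonneg hN hP)) hα.le
      _ = α * K ^ 4 * ((F N (normV U ^ (β - 1)) * normV U ^ (β - 1)) *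
          (normV U * ‖fieldV Z‖)) := by ring
      _ ≤ α * K ^ 4 * (N * (normV U * ‖Z‖)) := by
          refine mul_le_mul_of_nonneg_left ?_ (by positivity)
          refine mul_le_mul (F_mul_le hN hP) ?_ (by positivity) hN.le
          exact mul_le_mul_of_nonneg_left (norm_fieldV_le_norm Z) hU
      _ = _ := by ring
  calc _ ≤ μ * (normV U * ‖Z‖) + K ^ 3 * N * (normV U * ‖Z‖) +
        α * K ^ 4 * N * (normV U * ‖Z‖) :=
        (abs_add_le _ _).trans (add_le_add ((abs_add_le _ _).trans (add_le_add t1 t2)) t3)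
    _ = (μ + K ^ 3 * N + α * K ^ 4 * N) * normV U * ‖Z‖ := by ring
    _ ≤ _ := by
      gcongr
      exact normV_le_norm U

theorem aestronglyMeasurable_opDual (hK : IsSobolevConst Ω K) {β : ℝ} (hβ₁ : 1 ≤ β) (hβ₃ : β ≤ 3)
    (μ α N : ℝ) {ν : Measure ℝ} {U : ℝ → V Ω} (hU : AEStronglyMeasurable U ν) :
    AEStronglyMeasurable (fun t => opDual hK hβ₁ hβ₃ μ α N (U t)) ν := by
  have hn : AEMeasurable (fun t => normV (U t)) ν :=
    (continuous_normV.comp_aestronglyMeasurable hU).aemeasurable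
  have hF1 : AEStronglyMeasurable (fun t => F N (normV (U t))) ν :=
    ((measurable_F N).comp_aemeasurable hn).aestronglyMeasurable
  have hF2 : AEStronglyMeasurable (fun t => α * F N (normV (U t) ^ (β - 1))) ν :=
    (((measurable_F N).comp_aemeasurable (hn.pow_const (β - 1))).aestronglyMeasurable).const_mul α
  have hS : AEStronglyMeasurable (fun t => stokes (U t)) ν :=
    continuous_stokes.comp_aestronglyMeasurable hU
  have hB : AEStronglyMeasurable (fun t => bForm hK (U t) (U t)) ν :=
    (((bForm hK).continuous.clm_apply continuous_id).comp_aestronglyMeasurable hU)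
  have hD : AEStronglyMeasurable (fun t => dampDual hK hβ₁ hβ₃ (U t)) ν :=
    (continuous_dampDual hK hβ₁ hβ₃).comp_aestronglyMeasurable hU
  exact ((hS.const_smul μ).add (hF1.smul hB)).add (hF2.smul hD)

/-- The monotonicity estimate behind the continuous dependence. -/
theorem opDual_sub_le (hK : IsSobolevConst Ω K) {β : ℝ} (hβ₁ : 1 ≤ β) (hβ₃ : β ≤ 3)
    {μ α M N : ℝ} (hμ : 0 < μ) (hα : 0 < α) (hM : 0 < M) (hN : 0 < N) (U W : V Ω) (g : L2 Ω) :
    2 * (⟪g, fieldV (W - U)⟫ - (opDual hK hβ₁ hβ₃ μ α M W (W - U)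
        - opDual hK hβ₁ hβ₃ μ α N U (W - U))) ≤
      rate K μ α M N * ‖fieldV (W - U)‖ ^ 2 + 4 * |M - N| ^ 2 * normV U ^ 2 + ‖g‖ ^ 2 := by
  have hconv := (abs_le.1 (hK.convection_sub_le hM hN U W)).1
  have hdamp := mul_le_mul_of_nonneg_left (hK.damping_sub_ge hβ₁ hβ₃ hM hN U W) hα.le
  have hin : innerV W (W - U) - innerV U (W - U) = normV (W - U) ^ 2 := by
    simp only [innerV, normV]
    rw [← inner_sub_left, ← real_inner_self_eq_norm_sq]
    rfl
  have hg : ⟪g, fieldV (W - U)⟫ ≤ ‖g‖ * ‖fieldV (W - U)‖ := real_inner_le_norm _ _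
  have hq : (√‖fieldV (W - U)‖ * √(normV (W - U))) ^ 2 = normV (W - U) * ‖fieldV (W - U)‖ := by
    rw [mul_pow, Real.sq_sqrt (norm_nonneg _), Real.sq_sqrt (normV_nonneg _), mul_comm]
  have hy := young_absorption (α := α) (k := K) (L := M + N) (d := |M - N|) (r := normV U)
    (g := ‖g‖) hμ hq
  rw [opDual_apply, opDual_apply]
  unfold rate
  have hμin : μ * innerV W (W - U) - μ * innerV U (W - U) = μ * normV (W - U) ^ 2 := by
    rw [← mul_sub, hin]
  rw [mul_pow] at hy
  linarith

end Operator

/-! ### Weak solutions as curves with time derivative in L²(τ,T;V'). -/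

variable {μ α β N M τ T : ℝ}

theorem fieldV_toV {x : H Ω} (hx : MemV x) : fieldV (toV x) = (x : L2 Ω) := by
  unfold toV
  rw [dif_pos hx]
  exact hx.choose_spec

/-- As β + 1 ≤ 4 < 6 and Ω has finite volume, the restriction of test fields to V ∩ L^(β+1) excludes
nothing. -/
theorem IsSobolevConst.memLp_fieldV (hK : IsSobolevConst Ω K) (U : V Ω) (hβ₃ : β ≤ 3) :
    MemLp (fieldV U) (ENNReal.ofReal (β + 1)) (volume.restrict Ω) := by
  have : IsFiniteMeasure (volume.restrict Ω) :=
    ⟨by rw [Measure.restrict_apply_univ]; exact hK.volume_le.trans_lt ENNReal.ofReal_lt_top⟩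
  have h6 : MemLp (fieldV U) 6 (volume.restrict Ω) :=
    ⟨Lp.aestronglyMeasurable _, (hK.eLpNorm_six_le U).trans_lt ENNReal.ofReal_lt_top⟩
  refine h6.mono_exponent ?_
  rw [ENNReal.ofReal_le_iff_le_toReal (by simp)]
  simp only [ENNReal.toReal_ofNat]
  linarith

section Solution

variable {f : ℝ → VDual Ω} {u₀ : H Ω} {u : ℝ → H Ω}

/-- The time derivative `f - A(u)` of a weak solution, as an element of `V'`. -/
noncomputable def timeDeriv (hK : IsSobolevConst Ω K) (hβ₁ : 1 ≤ β) (hβ₃ : β ≤ 3) (μ α N : ℝ)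
    (f : ℝ → VDual Ω) (u : ℝ → H Ω) (t : ℝ) : VDual Ω :=
  f t - opDual hK hβ₁ hβ₃ μ α N (toV (u t))

theorem IsWeakSolution.memLp_opDual (hu : IsWeakSolution μ α β N τ T f u₀ u)
    (hK : IsSobolevConst Ω K) (hβ₁ : 1 ≤ β) (hβ₃ : β ≤ 3) (hμ : 0 < μ) (hα : 0 < α) (hN : 0 < N) :
    MemLp (fun t => opDual hK hβ₁ hβ₃ μ α N (toV (u t))) 2 (volume.restrict (Ioc τ T)) :=
  MemLp.of_le_mul (E := VDual Ω) (F := V Ω) hu.memLp_V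
    (aestronglyMeasurable_opDual hK hβ₁ hβ₃ μ α N hu.memLp_V.aestronglyMeasurable)
    (Eventually.of_forall fun t => norm_opDual_le hK hβ₁ hβ₃ hμ hα hN (toV (u t)))

theorem IsWeakSolution.memLp_timeDeriv (hu : IsWeakSolution μ α β N τ T f u₀ u)
    (hK : IsSobolevConst Ω K) (hβ₁ : 1 ≤ β) (hβ₃ : β ≤ 3) (hμ : 0 < μ) (hα : 0 < α) (hN : 0 < N) :
    MemLp (timeDeriv hK hβ₁ hβ₃ μ α N f u) 2 (volume.restrict (Ioc τ T)) :=
  MemLp.sub (E := VDual Ω) hu.forcing (hu.memLp_opDual hK hβ₁ hβ₃ hμ hα hN)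

section Pairing

variable {D X : Type*} [NormedAddCommGroup D] [NormedSpace ℝ D] [NormedAddCommGroup X]
  [NormedSpace ℝ X] {ν : Measure ℝ} {G : ℝ → D} {W : ℝ → X}

theorem integrable_pairing_const [IsFiniteMeasure ν] (P : D →L[ℝ] X →L[ℝ] ℝ) (hG : MemLp G 2 ν)
    (φ : X) : Integrable (fun t => P (G t) φ) ν :=
  (P.flip φ).integrable_comp (hG.integrable (by norm_num))

theorem integrable_pairing (P : D →L[ℝ] X →L[ℝ] ℝ) (hG : MemLp G 2 ν) (hW : MemLp W 2 ν) :
    Integrable (fun t => P (G t) (W t)) ν :=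
  memLp_one_iff_integrable.1 (P.memLp_of_bilin 1 hG hW)

end Pairing

theorem intervalIntegrable_apply_mul {G : ℝ → VDual Ω} (hτT : τ ≤ T)
    (hG : MemLp G 2 (volume.restrict (Ioc τ T))) (φ : V Ω) {ψ : ℝ → ℝ} (hψ : Continuous ψ) :
    IntervalIntegrable (fun t => G t φ * ψ t) volume τ T := by
  have h1 := integrable_pairing_const (D := VDual Ω) (X := V Ω)
    (ContinuousLinearMap.id ℝ (VDual Ω)) hG φ
  exact ((intervalIntegrable_iff_integrableOn_Ioc_of_le hτT).2 h1).mul_continuousOn hψ.continuousOn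

theorem IsWeakSolution.weak_timeDeriv (hu : IsWeakSolution μ α β N τ T f u₀ u) (hτT : τ < T)
    (hK : IsSobolevConst Ω K) (hβ₁ : 1 ≤ β) (hβ₃ : β ≤ 3) (hμ : 0 < μ) (hα : 0 < α) (hN : 0 < N)
    (φ : V Ω) {ψ : ℝ → ℝ} (hψ : ContDiff ℝ ∞ ψ) (hc : HasCompactSupport ψ)
    (hs : tsupport ψ ⊆ Ioo τ T) :
    -(∫ t in τ..T, ⟪u t, inclH φ⟫ * deriv ψ t) =
      ∫ t in τ..T, timeDeriv hK hβ₁ hβ₃ μ α N f u t φ * ψ t := by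
  have heq := hu.equation φ (hK.memLp_fieldV φ hβ₃) ψ hψ hc hs
  have h1 := intervalIntegrable_apply_mul hτT.le hu.forcing φ hψ.continuous
  have h2 := intervalIntegrable_apply_mul hτT.le (hu.memLp_opDual hK hβ₁ hβ₃ hμ hα hN) φ
    hψ.continuous
  simp_rw [← opDual_apply hK hβ₁ hβ₃] at heq
  have h3 : ∫ t in τ..T, timeDeriv hK hβ₁ hβ₃ μ α N f u t φ * ψ t
      = (∫ t in τ..T, f t φ * ψ t)
        - ∫ t in τ..T, opDual hK hβ₁ hβ₃ μ α N (toV (u t)) φ * ψ t := by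
    rw [← intervalIntegral.integral_sub h1 h2]
    refine intervalIntegral.integral_congr fun t _ => ?_
    simp only [timeDeriv, sub_apply]
    ring
  rw [h3, ← heq]
  simp only [Submodule.coe_inner, coe_inclH]
  ring

theorem IsWeakSolution.integrableOn_normV_sq (hu : IsWeakSolution μ α β N τ T f u₀ u) :
    IntegrableOn (fun t => normV (toV (u t)) ^ 2) (Ioc τ T) := by
  refine (hu.memLp_V.integrable_norm_pow (by norm_num)).mono'
    (((continuous_normV.comp_aestronglyMeasurable hu.memLp_V.aestronglyMeasurable)).pow 2)
    (Eventually.of_forall fun t => ?_)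
  rw [Real.norm_of_nonneg (sq_nonneg _)]
  exact pow_le_pow_left₀ (normV_nonneg _) (normV_le_norm _) 2

end Solution

theorem _root_.MeasureTheory.IntegrableOn.intervalIntegrable_of_le {h : ℝ → ℝ} (hh : IntegrableOn h (Ioc τ T)) {s t : ℝ}
    (hs : τ ≤ s) (hst : s ≤ t) (ht : t ≤ T) : IntervalIntegrable h volume s t :=
  (intervalIntegrable_iff_integrableOn_Ioc_of_le hst).2 (hh.mono_set (Ioc_subset_Ioc hs ht))

theorem integral_le_integral_of_nonneg {h : ℝ → ℝ} (hh : IntegrableOn h (Ioc τ T))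
    (h0 : ∀ t, 0 ≤ h t) {s t : ℝ} (hs : τ ≤ s) (hst : s ≤ t) (ht : t ≤ T) :
    ∫ r in τ..s, h r ≤ ∫ r in τ..t, h r :=
  intervalIntegral.integral_mono_interval le_rfl hs hst (Eventually.of_forall h0)
    (hh.intervalIntegrable_of_le le_rfl (hs.trans hst) ht)

/-! ### The estimate and the theorem. -/

/-- The continuous dependence estimate. -/
theorem norm_sub_sq_le (hK : IsSobolevConst Ω K) (hβ₁ : 1 ≤ β) (hβ₃ : β ≤ 3) (hμ : 0 < μ)
    (hα : 0 < α) (hM : 0 < M) (hN : 0 < N) (hτT : τ < T) {fu fv : ℝ → VDual Ω} {g : ℝ → H Ω}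
    (hg : ForcingDiff τ T fu fv g) {uτ vτ : H Ω} {u v : ℝ → H Ω}
    (hu : IsWeakSolution μ α β N τ T fu uτ u) (hv : IsWeakSolution μ α β M τ T fv vτ v)
    {t : ℝ} (ht : t ∈ Icc τ T) :
    ‖v t - u t‖ ^ 2 ≤ 4 * Real.exp (rate K μ α M N * (t - τ)) *
      (‖vτ - uτ‖ ^ 2 + (∫ s in τ..t, normV (toV (u s)) ^ 2) * |M - N| ^ 2
        + ∫ s in τ..t, ‖g s‖ ^ 2) := by
  set γ := rate K μ α M N with hγ
  have hγ0 : 0 < γ := rate_pos hμ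
  set W : ℝ → V Ω := fun s => toV (v s) - toV (u s) with hW
  set G : ℝ → VDual Ω := fun s => timeDeriv hK hβ₁ hβ₃ μ α M fv v s
    - timeDeriv hK hβ₁ hβ₃ μ α N fu u s with hG
  have hW2 : MemLp W 2 (volume.restrict (Ioc τ T)) := hv.memLp_V.sub hu.memLp_V
  have hG2 : MemLp G 2 (volume.restrict (Ioc τ T)) :=
    MemLp.sub (E := VDual Ω) (hv.memLp_timeDeriv hK hβ₁ hβ₃ hμ hα hM)
      (hu.memLp_timeDeriv hK hβ₁ hβ₃ hμ hα hN)
  -- The default value 0 of `toV` can occur only on a null set of times, which the integrals do not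
  -- see.
  have hfield : ∀ᵐ s ∂volume.restrict (Ioc τ T), inclH (W s) = v s - u s := by
    filter_upwards [hu.memV, hv.memV] with s h1 h2
    refine Subtype.ext ?_
    rw [coe_inclH]
    show fieldV (toV (v s)) - fieldV (toV (u s)) = (v s : L2 Ω) - (u s : L2 Ω)
    rw [fieldV_toV h1, fieldV_toV h2]
  have hweak : ∀ h : H Ω, ContinuousOn (fun s => ⟪v s - u s, h⟫) (Icc τ T) := by
    intro h
    simp_rw [inner_sub_left]
    exact (hv.weakly_continuous h).sub (hu.weakly_continuous h)
  have henergy : ∀ s ∈ Icc τ T, ‖v s - u s‖ ^ 2 ≤ ‖vτ - uτ‖ ^ 2 + 2 * ∫ r in τ..s, G r (W r) := by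
    intro s hs
    have := energy_inequality (H := H Ω) (V := V Ω) (D := VDual Ω)
      (ContinuousLinearMap.id ℝ (VDual Ω)) inclH hτT
      (w := fun s => v s - u s) (W := W) (G := G) hweak hW2 hG2 hfield ?_ hs
    · simpa only [hu.initial, hv.initial, ContinuousLinearMap.id_apply] using this
    · intro φ ψ hψ hc hsupp
      have hdc : Continuous (deriv ψ) := hψ.continuous_deriv (by simp)
      have hi : ∀ {w : ℝ → H Ω}, (∀ h : H Ω, ContinuousOn (fun t => ⟪w t, h⟫) (Icc τ T)) →
          IntervalIntegrable (fun r => ⟪w r, inclH φ⟫ * deriv ψ r) volume τ T := fun hw =>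
        ContinuousOn.intervalIntegrable (by
          rw [uIcc_of_le hτT.le]; exact (hw (inclH φ)).mul hdc.continuousOn)
      have e1 := hv.weak_timeDeriv hτT hK hβ₁ hβ₃ hμ hα hM φ hψ hc hsupp
      have e2 := hu.weak_timeDeriv hτT hK hβ₁ hβ₃ hμ hα hN φ hψ hc hsupp
      have e3 : ∫ r in τ..T, ⟪v r - u r, inclH φ⟫ * deriv ψ r
          = (∫ r in τ..T, ⟪v r, inclH φ⟫ * deriv ψ r)
            - ∫ r in τ..T, ⟪u r, inclH φ⟫ * deriv ψ r := by
        rw [← intervalIntegral.integral_sub (hi hv.weakly_continuous) (hi hu.weakly_continuous)]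
        refine intervalIntegral.integral_congr fun r _ => ?_
        simp only [inner_sub_left, sub_mul]
      have e4 : ∫ r in τ..T, G r φ * ψ r
          = (∫ r in τ..T, timeDeriv hK hβ₁ hβ₃ μ α M fv v r φ * ψ r)
            - ∫ r in τ..T, timeDeriv hK hβ₁ hβ₃ μ α N fu u r φ * ψ r := by
        rw [← intervalIntegral.integral_sub
          (intervalIntegrable_apply_mul hτT.le (hv.memLp_timeDeriv hK hβ₁ hβ₃ hμ hα hM) φ
            hψ.continuous)
          (intervalIntegrable_apply_mul hτT.le (hu.memLp_timeDeriv hK hβ₁ hβ₃ hμ hα hN) φ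
            hψ.continuous)]
        refine intervalIntegral.integral_congr fun r _ => ?_
        simp only [hG, sub_apply, sub_mul]
      simp only [ContinuousLinearMap.id_apply]
      rw [e3, e4, ← e1, ← e2]
      ring
  have hpoint : ∀ᵐ s ∂volume.restrict (Ioc τ T), 2 * G s (W s) ≤
      γ * ‖v s - u s‖ ^ 2 + 4 * |M - N| ^ 2 * normV (toV (u s)) ^ 2 + ‖g s‖ ^ 2 := by
    filter_upwards [hfield, hg.2] with s h1 h2
    have h3 := opDual_sub_le hK hβ₁ hβ₃ hμ hα hM hN (toV (u s)) (toV (v s)) (g s : L2 Ω)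
    have h4 : ‖fieldV (toV (v s) - toV (u s))‖ = ‖v s - u s‖ := by
      rw [← h1]; rfl
    rw [h4] at h3
    have h5 : G s (W s) = ⟪(g s : L2 Ω), fieldV (toV (v s) - toV (u s))⟫ -
        (opDual hK hβ₁ hβ₃ μ α M (toV (v s)) (toV (v s) - toV (u s))
          - opDual hK hβ₁ hβ₃ μ α N (toV (u s)) (toV (v s) - toV (u s))) := by
      have h6 : fv s (W s) - fu s (W s) = ⟪(g s : L2 Ω), fieldV (toV (v s) - toV (u s))⟫ := by
        rw [← sub_apply, h2]; rfl
      rw [← h6]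
      simp only [hG, hW, timeDeriv, sub_apply]
      ring
    rw [h5]
    exact h3
  have hGW : IntegrableOn (fun s => 2 * G s (W s)) (Ioc τ T) := by
    have := integrable_pairing (D := VDual Ω) (X := V Ω) (ContinuousLinearMap.id ℝ (VDual Ω))
      hG2 hW2
    exact this.const_mul 2
  have hφi : IntegrableOn (fun s => ‖v s - u s‖ ^ 2) (Ioc τ T) := by
    have : MemLp (fun s => v s - u s) 2 (volume.restrict (Ioc τ T)) :=
      (hv.memLp_top.sub hu.memLp_top).mono_exponent le_top
    exact this.integrable_norm_pow (by norm_num)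
  have hui := hu.integrableOn_normV_sq
  have hgi : IntegrableOn (fun s => ‖g s‖ ^ 2) (Ioc τ T) := hg.1.integrable_norm_pow (by norm_num)
  set I : ℝ → ℝ := fun s => ∫ r in τ..s, normV (toV (u r)) ^ 2 with hI
  set J : ℝ → ℝ := fun s => ∫ r in τ..s, ‖g r‖ ^ 2 with hJ
  have hbound : ∀ s ∈ Icc τ T, ‖v s - u s‖ ^ 2 ≤
      (‖vτ - uτ‖ ^ 2 + 4 * |M - N| ^ 2 * I s + J s) + γ * ∫ r in τ..s, ‖v r - u r‖ ^ 2 := by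
    intro s hs
    have i1 := hφi.intervalIntegrable_of_le le_rfl hs.1 hs.2
    have i2 := hui.intervalIntegrable_of_le le_rfl hs.1 hs.2
    have i3 := hgi.intervalIntegrable_of_le le_rfl hs.1 hs.2
    have hle : ∫ r in τ..s, 2 * G r (W r) ≤ ∫ r in τ..s,
        (γ * ‖v r - u r‖ ^ 2 + 4 * |M - N| ^ 2 * normV (toV (u r)) ^ 2 + ‖g r‖ ^ 2) := by
      refine intervalIntegral.integral_mono_ae_restrict hs.1
        (hGW.intervalIntegrable_of_le le_rfl hs.1 hs.2)
        (((i1.const_mul γ).add (i2.const_mul _)).add i3) ?_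
      rw [Measure.restrict_congr_set Ioc_ae_eq_Icc.symm]
      exact ae_mono (Measure.restrict_mono (Ioc_subset_Ioc_right hs.2) le_rfl) hpoint
    rw [intervalIntegral.integral_const_mul, intervalIntegral.integral_add
      ((i1.const_mul γ).add (i2.const_mul _)) i3, intervalIntegral.integral_add
      (i1.const_mul γ) (i2.const_mul _), intervalIntegral.integral_const_mul,
      intervalIntegral.integral_const_mul] at hle
    have := henergy s hs
    simp only [hI, hJ]
    linarith
  -- Gronwall is run on [τ, t] with t fixed: the data terms increase with time, so their values at t
  -- serve as the constant.
  have hgron := le_mul_exp_of_le_add_integral (a := τ) (b := t)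
    (A := ‖vτ - uτ‖ ^ 2 + 4 * |M - N| ^ 2 * I t + J t) (c := γ) ht.1 hγ0.le
    (φ := fun s => ‖v s - u s‖ ^ 2) (hφi.intervalIntegrable_of_le le_rfl ht.1 ht.2) (by
      intro s hs
      refine (hbound s ⟨hs.1, hs.2.trans ht.2⟩).trans ?_
      have h1 : I s ≤ I t :=
        integral_le_integral_of_nonneg hui (fun _ => sq_nonneg _) hs.1 hs.2 ht.2
      have h2 : J s ≤ J t :=
        integral_le_integral_of_nonneg hgi (fun _ => sq_nonneg _) hs.1 hs.2 ht.2
      gcongr)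
  refine hgron.trans ?_
  have hJ0 : 0 ≤ J t := intervalIntegral.integral_nonneg ht.1 fun _ _ => sq_nonneg _
  have hE := (Real.exp_pos (γ * (t - τ))).le
  calc (‖vτ - uτ‖ ^ 2 + 4 * |M - N| ^ 2 * I t + J t) * Real.exp (γ * (t - τ))
      ≤ (4 * (‖vτ - uτ‖ ^ 2 + I t * |M - N| ^ 2 + J t)) * Real.exp (γ * (t - τ)) := by
        refine mul_le_mul_of_nonneg_right ?_ hE
        nlinarith [sq_nonneg ‖vτ - uτ‖]
    _ = _ := by ring

end GMNSED

theorem mainTheorem9 (Ω : Set GMNSED.E3) (hΩ_open : IsOpen Ω) (hΩ_bdd : Bornology.IsBounded Ω)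
    (μ α β : ℝ) (hμ : 0 < μ) (hα : 0 < α) (hβ₁ : 1 ≤ β) (hβ₃ : β ≤ 3) :
    -- the estimate, with `C` and `γ` depending only on `Ω, μ, α, β` (and `γ` on `M, N`)
    (∃ C : ℝ, 0 < C ∧ ∃ γ : ℝ → ℝ → ℝ, (∀ M N : ℝ, 0 < M → 0 < N → 0 < γ M N) ∧
      ∀ (M N : ℝ), 0 < M → 0 < N → ∀ (τ T : ℝ), τ < T →
      ∀ (fu fv : ℝ → GMNSED.VDual Ω) (g : ℝ → GMNSED.H Ω), GMNSED.ForcingDiff τ T fu fv g →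
      ∀ (uτ vτ : GMNSED.H Ω) (u v : ℝ → GMNSED.H Ω),
        GMNSED.IsWeakSolution μ α β N τ T fu uτ u →
        GMNSED.IsWeakSolution μ α β M τ T fv vτ v →
        ∀ t ∈ Set.Icc τ T,
          ‖v t - u t‖ ^ 2 ≤ C * Real.exp (γ M N * (t - τ)) *
            (‖vτ - uτ‖ ^ 2
              + (∫ s in τ..t, GMNSED.normV (GMNSED.toV (u s)) ^ 2) * |M - N| ^ 2
              + ∫ s in τ..t, ‖g s‖ ^ 2)) ∧
    -- continuous dependence on the cutoff, the initial datum and the forcing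
    (∀ (N : ℝ), 0 < N → ∀ (τ T : ℝ), τ < T →
      ∀ (fu : ℝ → GMNSED.VDual Ω) (uτ : GMNSED.H Ω) (u : ℝ → GMNSED.H Ω),
        GMNSED.IsWeakSolution μ α β N τ T fu uτ u →
        ∀ ε : ℝ, 0 < ε → ∃ δ : ℝ, 0 < δ ∧
          ∀ (M : ℝ), 0 < M → |M - N| < δ →
          ∀ (fv : ℝ → GMNSED.VDual Ω) (g : ℝ → GMNSED.H Ω), GMNSED.ForcingDiff τ T fu fv g →
            (∫ s in τ..T, ‖g s‖ ^ 2) < δ →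
          ∀ (vτ : GMNSED.H Ω) (v : ℝ → GMNSED.H Ω), ‖vτ - uτ‖ < δ →
            GMNSED.IsWeakSolution μ α β M τ T fv vτ v →
            ∀ t ∈ Set.Icc τ T, ‖v t - u t‖ < ε) := by
  obtain ⟨K, hK⟩ := GMNSED.exists_isSobolevConst hΩ_bdd
  refine ⟨⟨4, by norm_num, GMNSED.rate K μ α, fun M N _ _ => GMNSED.rate_pos hμ, ?_⟩, ?_⟩
  · intro M N hM hN τ T hτT fu fv g hg uτ vτ u v hu hv t ht
    exact GMNSED.norm_sub_sq_le hK hβ₁ hβ₃ hμ hα hM hN hτT hg hu hv ht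
  · intro N hN τ T hτT fu uτ u hu ε hε
    set I := ∫ s in τ..T, GMNSED.normV (GMNSED.toV (u s)) ^ 2 with hI
    have hI0 : 0 ≤ I := intervalIntegral.integral_nonneg hτT.le fun _ _ => sq_nonneg _
    -- The choice δ ≤ 1 forces M ≤ N + 1, so the exponential factor has a bound that does not depend
    -- on v.
    set E := 4 * Real.exp (GMNSED.rate K μ α (N + 1) N * (T - τ)) with hE
    have hE0 : 0 < E := by positivity
    -- The three data terms are at most δ, Iδ and δ, using x² ≤ δ for 0 ≤ x < δ ≤ 1. Thus |v(t) -
    -- u(t)|² ≤ E(2 + I)δ ≤ ε²/2; the extra factor 2 gives strict inequality.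
    refine ⟨min 1 (ε ^ 2 / (2 * (E * (2 + I)))), by positivity, ?_⟩
    intro M hM hMN fv g hg hgδ vτ v hvδ hv t ht
    set δ := min 1 (ε ^ 2 / (2 * (E * (2 + I)))) with hδ
    have hδ0 : 0 < δ := by positivity
    have hδ1 : δ ≤ 1 := min_le_left _ _
    have hδ2 : E * (2 + I) * δ ≤ ε ^ 2 / 2 := by
      have h1 : δ ≤ ε ^ 2 / (2 * (E * (2 + I))) := min_le_right _ _
      have h2 : 0 < E * (2 + I) := by positivity
      calc E * (2 + I) * δ ≤ E * (2 + I) * (ε ^ 2 / (2 * (E * (2 + I)))) :=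
            mul_le_mul_of_nonneg_left h1 h2.le
        _ = ε ^ 2 / 2 := by field_simp
    have hsq : ∀ x : ℝ, 0 ≤ x → x < δ → x ^ 2 ≤ δ := fun x h0 h1 => by nlinarith
    have hest := GMNSED.norm_sub_sq_le hK hβ₁ hβ₃ hμ hα hM hN hτT hg hu hv ht
    have hrate : GMNSED.rate K μ α M N * (t - τ) ≤ GMNSED.rate K μ α (N + 1) N * (T - τ) := by
      have hMle : M ≤ N + 1 := by linarith [(abs_lt.1 hMN).2]
      refine mul_le_mul (GMNSED.rate_mono hμ hM.le hN.le hMle) (by linarith [ht.2])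
        (by linarith [ht.1]) (GMNSED.rate_pos hμ).le
    have hIt : (∫ s in τ..t, GMNSED.normV (GMNSED.toV (u s)) ^ 2) ≤ I :=
      GMNSED.integral_le_integral_of_nonneg hu.integrableOn_normV_sq (fun _ => sq_nonneg _)
        ht.1 ht.2 le_rfl
    have hgt : (∫ s in τ..t, ‖g s‖ ^ 2) ≤ δ :=
      (GMNSED.integral_le_integral_of_nonneg (hg.1.integrable_norm_pow (by norm_num))
        (fun _ => sq_nonneg _) ht.1 ht.2 le_rfl).trans hgδ.le
    have hg0 : 0 ≤ ∫ s in τ..t, ‖g s‖ ^ 2 :=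
      intervalIntegral.integral_nonneg ht.1 fun _ _ => sq_nonneg _
    have hIt0 : 0 ≤ ∫ s in τ..t, GMNSED.normV (GMNSED.toV (u s)) ^ 2 :=
      intervalIntegral.integral_nonneg ht.1 fun _ _ => sq_nonneg _
    have hfin : ‖v t - u t‖ ^ 2 < ε ^ 2 := by
      calc ‖v t - u t‖ ^ 2 ≤ E * (δ + I * δ + δ) := by
            refine hest.trans ?_
            rw [hE]
            gcongr
            · exact hsq _ (norm_nonneg _) hvδ
            · exact hsq _ (abs_nonneg _) hMN
        _ = E * (2 + I) * δ := by ring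
        _ ≤ ε ^ 2 / 2 := hδ2
        _ < ε ^ 2 := by nlinarith
    exact lt_of_pow_lt_pow_left₀ 2 hε.le hfin
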